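/- **Setting.** Let $w_1,\dots,w_m$ be nonzero real polynomials in $n$ variables and $d_1,\dots,d_m\ge 0$ integers. Let $\mathcal V$ be the space of polynomials $\sum_i w_i r_i$ with $\deg r_i\le 2d_i$, with ordered basis $\mathbf q=(q_1,\dots,q_U)$; for each $i$ let $\mathbf p_i$ be an ordered basis of the polynomials of degree at most $d_i$. Identify polynomials in $\mathcal V$ with their coefficient vectors in $\mathbb R^U$. Let $\Sigma\subset\mathbb R^U$ be the cone of weighted sums of squares $\sum_i w_i\sigma_i$, where each $\sigma_i$ is a sum of squares of polynomials of degree at most $d_i$, and $\Sigma^*$ its dual cone. Let $\Lambda=\Lambda_1\oplus\dots\oplus\Lambda_m$, where $\Lambda_i$ is the linear map with $\Lambda_i(\mathbf q)=w_i\mathbf p_i\mathbf p_i^{\mathrm T}$; let $f(\mathbf x)=-\ln\det\Lambda(\mathbf x)$ on $(\Sigma^*)^\circ$, with gradient $g$ and Hessian $H$, and put $\|\mathbf v\|_{\mathbf x}=(\mathbf v^{\mathrm T}H(\mathbf x)\mathbf v)^{1/2}$, $\|\mathbf s\|^*_{\mathbf x}=(\mathbf s^{\mathrm T}H(\mathbf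 x)^{-1}\mathbf s)^{1/2}$. A vector $\mathbf y\in(\Sigma^*)^\circ$ is the gradient certificate of $\mathbf s$ if $-g(\mathbf y)=\mathbf s$; a vector $\mathbf x\in(\Sigma^*)^\circ$ certifies $\mathbf s\in\Sigma$ if $H(\mathbf x)^{-1}\mathbf s\in\Sigma^*$. Assume $(\Sigma^*)^\circ\ne\emptyset$ and that the constant polynomial $1$ lies in $\mathcal V$, with $\mathbf 1\in\Sigma^\circ$. **Algorithm.** Parameters: $0<r\le\frac14$ and $\frac{r^2}{1-2r}<r_N<\frac r{1+2r}$. Input: $\mathbf t\in\mathbb R^U$. One iteration of the main loop maps a state $(\mathbf x,c)$ to a state $(\mathbf x_N,c_+')$ as follows. (a) Set $\mathbf x_+=2\mathbf x-H(\mathbf x)^{-1}(\mathbf t-c\mathbf 1)$. (b) Round $\mathbf x_+$ componentwise to a nearest point $\mathbf x_N\in\frac1N\mathbb Z^U$, where $N=\Big\lceil\frac{\sqrt U}{2}\,\frac{1+r_N}{r_N-r^2/(1-2r)}\,\|H(\mathbf x_+)^{1/2}\|\Big\rceil$. (c) Let $c_+$ be the larger solution $s$ of the quadratic equation $\|\mathbf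 x_N-H(\mathbf x_N)^{-1}(\mathbf t-s\mathbf 1)\|_{\mathbf x_N}=\frac r{r+1}$. (d) Let $c_+'$ be a rational number of smallest denominator in $[c+\frac{c_+-c}2,\,c_+]$. A state $(\mathbf x,c)$ is called *good* if $\mathbf x\in(\Sigma^*)^\circ$, $\mathbf t-c\mathbf 1$ has a gradient certificate $\mathbf y$, and $\|\mathbf x-\mathbf y\|_{\mathbf x}\le r$. **Theorem.** There is a constant $C>0$, depending only on the data above (the weights, degrees and bases, that is, on $\Lambda$ and $\mathbf 1$), such that for all $r,r_N,\mathbf t$ as above, with $\rho=\frac r{r+1}-\frac{r_N}{1-r_N}>0$, the following hold. 0. If $\mathbf t\ne 0$ and $\mathbf x_1\in(\Sigma^*)^\circ$ satisfies $\delta:=\|-g(\mathbf x_1)-\mathbf 1\|^*_{\mathbf x_1}<\frac r{r+1}$, then $c_0=-\big(\frac r{r+1}-\delta\big)^{-1}\|\mathbf t\|^*_{\mathbf x_1}$ and $\mathbf x=-\frac1{c_0}\mathbf x_1$ form a good state $(\mathbf x,c_0)$. The maximum $c^*=\max\{c\mid\mathbf t-c\mathbf 1\in\Sigma\}$ exists.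 For every good state $(\mathbf x,c)$, with $\mathbf y$ the gradient certificate of $\mathbf t-c\mathbf 1$, all four steps can be carried out, and for every outcome of the choices in (b) and (d): 1. $\mathbf x_+\in(\Sigma^*)^\circ$ and $\|\mathbf x_+-\mathbf y\|_{\mathbf x_+}\le\frac{r^2}{1-2r}$. 2. $N>0$, $\mathbf x_N\in(\Sigma^*)^\circ$ and $\|\mathbf x_N-\mathbf y\|_{\mathbf x_N}\le r_N$. 3. $c_+>c$ and $c_+'>c$; the polynomial $\mathbf t-c_+\mathbf 1$ has a gradient certificate $\mathbf y_+$, and $\|\mathbf x_N-\mathbf y_+\|_{\mathbf x_N}\le r$; the new state $(\mathbf x_N,c_+')$ is again good, and $\mathbf x_N$ certifies $\mathbf t-c_+'\mathbf 1\in\Sigma$. 4. $c<c^*$ and $\Delta c=c_+'-c$ satisfies $\displaystyle\frac{\Delta c}{c^*-c}\ge\frac12\rho C$. 5. (Rational arithmetic.) $\mathbf x_N$ and $c_+'$ are rational. Suppose $\Lambda$ maps rational vectors to rational matrices and $\mathbf t,\mathbf 1$ are rational. If $\mathbf x,c$ are rational, then $\mathbf x_+$ is rational; if $r$ is rational, then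 the equation in (c) is equivalent to $\alpha s^2+\beta s+\gamma=0$ for some $\alpha,\beta,\gamma\in\mathbb Q$ with $\alpha>0$. Consequently, from every good starting state the main loop can be run indefinitely, and in every such run $(\mathbf x_k,c_k)_{k\ge0}$ all states are good, the bounds $c_k$ are strictly increasing and less than $c^*$, $\frac{c_{k+1}-c_k}{c^*-c_k}\ge\frac12\rho C$ for all $k$, and $c_k$ converges $q$-linearly to $c^*$ (that is, $c_k\to c^*$, and for some $\kappa\in[0,1)$, $|c_{k+1}-c^*|\le\kappa|c_k-c^*|$ for all $k$). -/

import Mathlib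

open MvPolynomial Filter Topology

noncomputable section

/-- `V_{n,k}`: real polynomials in `n` variables of degree at most `k`. -/
abbrev PolySpace (n k : ℕ) : Submodule ℝ (MvPolynomial (Fin n) ℝ) :=
  restrictTotalDegree (Fin n) ℝ k

/-- `V^w_{n,2d}`: the polynomials `∑ i, w i * r i` with `r i` of degree at most `2 * d i`. -/
def wsosSpace {n m : ℕ} (w : Fin m → MvPolynomial (Fin n) ℝ) (d : Fin m → ℕ) :
    Submodule ℝ (MvPolynomial (Fin n) ℝ) :=
  ⨆ i, (PolySpace n (2 * d i)).map (LinearMap.mulLeft ℝ (w i))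

theorem weight_mul_mem_wsosSpace {n m : ℕ} (w : Fin m → MvPolynomial (Fin n) ℝ)
    (d : Fin m → ℕ) (i : Fin m) (a b : PolySpace n (d i)) :
    w i * ((a : MvPolynomial (Fin n) ℝ) * (b : MvPolynomial (Fin n) ℝ)) ∈ wsosSpace w d := by
  refine Submodule.mem_iSup_of_mem i
    (Submodule.mem_map.2 ⟨(a : MvPolynomial (Fin n) ℝ) * b, ?_, rfl⟩)
  have ha := (mem_restrictTotalDegree (Fin n) (d i) (a : MvPolynomial (Fin n) ℝ)).1 a.2
  have hb := (mem_restrictTotalDegree (Fin n) (d i) (b : MvPolynomial (Fin n) ℝ)).1 b.2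
  refine (mem_restrictTotalDegree (Fin n) (2 * d i) _).2 ((totalDegree_mul _ _).trans ?_)
  omega

/-- Sums of squares of polynomials of degree at most `k`. -/
def sosCone (n k : ℕ) : Set (MvPolynomial (Fin n) ℝ) :=
  {σ | ∃ (l : ℕ) (h : Fin l → MvPolynomial (Fin n) ℝ),
    (∀ j, h j ∈ PolySpace n k) ∧ σ = ∑ j, h j ^ 2}

/-- The data of a weighted sum-of-squares cone together with its representation: nonzero weights,
degrees, an ordered basis `q` of `V^w_{n,2d}` and ordered bases `p i` of `V_{n,d i}`. -/
structure WSOS (n m : ℕ) where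
  w : Fin m → MvPolynomial (Fin n) ℝ
  w_ne_zero : ∀ i, w i ≠ 0
  d : Fin m → ℕ
  U : ℕ
  q : Module.Basis (Fin U) ℝ (wsosSpace w d)
  L : Fin m → ℕ
  p : ∀ i, Module.Basis (Fin (L i)) ℝ (PolySpace n (d i))

namespace WSOS

variable {n m : ℕ} (D : WSOS n m)

/-- Coefficient vectors in the basis `q`, and dual vectors. -/
abbrev E : Type := EuclideanSpace ℝ (Fin D.U)

/-- The polynomial with coefficient vector `s`. -/
def poly (s : D.E) : MvPolynomial (Fin n) ℝ :=
  ∑ u, s u • (D.q u : MvPolynomial (Fin n) ℝ)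

/-- The WSOS cone `Σ`, as a set of coefficient vectors. -/
def cone : Set D.E :=
  {s | ∃ σ : Fin m → MvPolynomial (Fin n) ℝ,
    (∀ i, σ i ∈ sosCone n (D.d i)) ∧ D.poly s = ∑ i, D.w i * σ i}

/-- The dual cone `Σ*`. -/
def dualCone : Set D.E :=
  {y | ∀ s ∈ D.cone, 0 ≤ inner ℝ s y}

/-- `Λ i`: the linear map with `Λ i (q) = w i * p i * (p i)ᵀ`; the coefficients of the polynomial
`w i * p i j * p i k` in the basis `q` are applied to the entries of `x`. -/
def Lam (i : Fin m) (x : D.E) : Matrix (Fin (D.L i)) (Fin (D.L i)) ℝ :=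
  Matrix.of fun j k => ∑ u,
    D.q.repr ⟨_, weight_mul_mem_wsosSpace D.w D.d i (D.p i j) (D.p i k)⟩ u * x u

/-- `Λ = Λ 1 ⊕ ⋯ ⊕ Λ m`. -/
def LamSum (x : D.E) : Matrix (Σ i, Fin (D.L i)) (Σ i, Fin (D.L i)) ℝ :=
  Matrix.blockDiagonal' fun i => D.Lam i x

/-- The barrier `f = -ln det Λ(x)` (used on the interior of `Σ*` only). -/
def barrier (x : D.E) : ℝ := -Real.log (D.LamSum x).det

/-- The gradient `g` of the barrier. -/
def grad (x : D.E) : D.E := gradient D.barrier x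

/-- The Hessian `H` of the barrier, as a linear operator. -/
def hess (x : D.E) : D.E →L[ℝ] D.E := fderiv ℝ D.grad x

/-- `H(x)⁻¹`. -/
def hessInv (x : D.E) : D.E →L[ℝ] D.E := (D.hess x).inverse

/-- The local norm `‖v‖_x`. -/
def localNorm (x v : D.E) : ℝ := √(inner ℝ v (D.hess x v))

/-- The dual local norm `‖s‖*_x`. -/
def dualNorm (x s : D.E) : ℝ := √(inner ℝ s (D.hessInv x s))

/-- `x` is a dual certificate of `s`. -/
def IsCert (x s : D.E) : Prop :=
  s ∈ D.cone ∧ x ∈ interior D.dualCone ∧ D.hessInv x s ∈ D.dualCone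

/-- `y` is the gradient certificate of `s`. -/
def IsGradCert (y s : D.E) : Prop :=
  y ∈ interior D.dualCone ∧ -D.grad y = s

/-! In what follows `e` is the coefficient vector of the constant polynomial one. -/

/-- The loop invariant `‖x - y‖_x ≤ r`, with `y` the gradient certificate of `t - c 1`. -/
def Invariant (e t : D.E) (r : ℝ) (x : D.E) (c : ℝ) : Prop :=
  x ∈ interior D.dualCone ∧ ∃ y, D.IsGradCert y (t - c • e) ∧ D.localNorm x (x - y) ≤ r

/-- The initial bound `c₀` computed from a certificate `x₁` of the polynomial one. -/
def initBound (e t : D.E) (r : ℝ) (x₁ : D.E) : ℝ :=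
  -((r / (r + 1) - D.dualNorm x₁ (-D.grad x₁ - e))⁻¹ * D.dualNorm x₁ t)

/-- The Newton step `x₊ = 2 x - H(x)⁻¹ (t - c 1)`. -/
def newtonPoint (e t : D.E) (x : D.E) (c : ℝ) : D.E :=
  (2 : ℝ) • x - D.hessInv x (t - c • e)

/-- The denominator `N`. The operator norm of `H(x₊)^{1/2}` is `√‖H(x₊)‖`, since `H(x₊)` is
symmetric positive definite. -/
def denominator (r rN : ℝ) (xp : D.E) : ℕ :=
  ⌈√(D.U : ℝ) / 2 * ((1 + rN) / (rN - r ^ 2 / (1 - 2 * r))) * √‖D.hess xp‖⌉₊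

/-- `xN` is a componentwise rounding of `xp` to a nearest point of `(1/N) ℤ^U`. -/
def IsRounding (N : ℕ) (xp xN : D.E) : Prop :=
  ∀ u, |xN u - xp u| ≤ 1 / (2 * (N : ℝ)) ∧ ∃ k : ℤ, xN u = (k : ℝ) / (N : ℝ)

/-- `s` solves the equation `‖xN - H(xN)⁻¹ (t - s 1)‖_{xN} = r / (r + 1)`. -/
def SolvesUpdate (e t : D.E) (r : ℝ) (xN : D.E) (s : ℝ) : Prop :=
  D.localNorm xN (xN - D.hessInv xN (t - s • e)) = r / (r + 1)

/-- `cp` is the largest solution of the equation for the new bound. -/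
def IsBoundUpdate (e t : D.E) (r : ℝ) (xN : D.E) (cp : ℝ) : Prop :=
  IsGreatest {s | D.SolvesUpdate e t r xN s} cp

/-- `c'` is a rational point of smallest denominator in `[c + (cp - c) / 2, cp]`. -/
def IsBoundRounding (c cp : ℝ) (c' : ℚ) : Prop :=
  (c' : ℝ) ∈ Set.Icc (c + (cp - c) / 2) cp ∧
    ∀ a : ℚ, (a : ℝ) ∈ Set.Icc (c + (cp - c) / 2) cp → c'.den ≤ a.den

/-- One pass through the main loop, from the state `(x, c)` to the state `(x', c')`. -/
def IsStep (e t : D.E) (r rN : ℝ) (x : D.E) (c : ℝ) (x' : D.E) (c' : ℝ) : Prop :=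
  D.IsRounding (D.denominator r rN (D.newtonPoint e t x c)) (D.newtonPoint e t x c) x' ∧
    ∃ (cp : ℝ) (a : ℚ), D.IsBoundUpdate e t r x' cp ∧ IsBoundRounding c cp a ∧ c' = (a : ℝ)

/-- A run of the main loop, without the stopping test. -/
def IsRun (e t : D.E) (r rN : ℝ) (x : ℕ → D.E) (c : ℕ → ℝ) : Prop :=
  ∀ k, D.IsStep e t r rN (x k) (c k) (x (k + 1)) (c (k + 1))

/-- All entries of the vector are rational. -/
def IsRatVec (v : D.E) : Prop := ∀ u, ∃ a : ℚ, v u = (a : ℝ)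

/-- `Λ` maps rational vectors to rational matrices. -/
def IsRatLam : Prop :=
  ∀ v, D.IsRatVec v → ∀ i j k, ∃ a : ℚ, D.Lam i v j k = (a : ℝ)

end WSOS

/-- `c` converges to `l`, the error shrinking by a fixed factor `κ < 1` in every step. -/
def QLinearlyConvergent (c : ℕ → ℝ) (l : ℝ) : Prop :=
  Tendsto c atTop (𝓝 l) ∧
    ∃ κ : ℝ, 0 ≤ κ ∧ κ < 1 ∧ ∀ k, |c (k + 1) - l| ≤ κ * |c k - l|

end

/-! The engine is self-concordance of the log-determinant barrier, in an elementary form. Through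
the adjoint `WSOS.adj` of Λ for the trace pairing, Σ is the image of the positive semidefinite
matrices, Σ* is the set Λ(x) ⪰ 0 with interior Λ(x) ≻ 0, and g and H are trace expressions in
Λ(x)⁻¹. Factor Λ(x) = CᵀC and put T = C⁻ᵀ Λ C⁻¹; then T x = 1 and ‖v‖_x is the Frobenius norm of T v
(`exists_isScaling`). Every comparison of x with z becomes an estimate for (1 + M)⁻¹ with M = T(z -
x).

Call ‖x - H(x)⁻¹ s‖_x the residual of s at x. It and the distance to the gradient certificate
control each other: distance a < 1 forces residual at most a/(1 - a) (`residual_le`), and residual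
at most r/(r + 1) forces a certificate to exist within distance r
(`exists_isGradCert_of_residual_le`). The Newton step makes the error quadratically small and
rounding raises it to at most rN, so the residual of t - c1 at xN is at most rN/(1 - rN), which is
r/(r + 1) - ρ. The squared residual is a quadratic in the bound with positive leading coefficient,
so its larger root c₊ lies beyond c. Convexity keeps the residual below r/(r + 1) on [c, c₊], which
restores the invariant at every rounded bound.

For the rate, raising the bound by Δ raises the residual by at most Δ‖1‖*, so c₊ - c ≥ ρ/‖1‖*.
Pairing t - c*1 with y, where ⟨-g(y), y⟩ = ν is the order of Λ, gives (c* - c)‖1‖* ≤ 2ν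
(`gap_mul_dualNorm_le`). Hence C = 1/(2ν); the extra factor 1/2 pays for rounding the bound. -/

/-! ### Frobenius norm estimates for (1 + M)⁻¹ -/

section Frobenius

open Matrix

attribute [local instance] Matrix.frobeniusNormedRing Matrix.frobeniusNormedAlgebra

variable {ι : Type*} [Fintype ι] [DecidableEq ι]

theorem frobenius_sq (M : Matrix ι ι ℝ) : ‖M‖ ^ 2 = (M * Mᵀ).trace := by
  have h := frobenius_norm_def M
  rw [show ‖M‖ = _ from h, ← Real.sqrt_eq_rpow, Real.sq_sqrt (by positivity)]
  simp [Matrix.trace, Matrix.mul_apply, pow_two]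

theorem frobenius_transpose (M : Matrix ι ι ℝ) : ‖Mᵀ‖ = ‖M‖ :=
  frobenius_norm_transpose M

theorem abs_trace_mul_le (M K : Matrix ι ι ℝ) : |(M * K).trace| ≤ ‖M‖ * ‖K‖ := by
  rw [← frobenius_transpose K]
  refine abs_le_of_sq_le_sq ?_ (by positivity)
  rw [mul_pow, frobenius_sq, frobenius_sq]
  have h := Finset.sum_mul_sq_le_sq_mul_sq (Finset.univ : Finset (ι × ι)) (fun z => M z.1 z.2)
    (fun z => K z.2 z.1)
  simp only [Fintype.sum_prod_type] at h
  simpa [Matrix.trace, Matrix.mul_apply, pow_two] using h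

/-- Cauchy–Schwarz against the rank-one matrix a aᵀ, whose Frobenius norm is a ⬝ a. This is how
Frobenius bounds yield semidefinite inequalities. -/
theorem abs_dotProduct_mulVec_le (M : Matrix ι ι ℝ) (a : ι → ℝ) :
    |a ⬝ᵥ M *ᵥ a| ≤ ‖M‖ * (a ⬝ᵥ a) := by
  have h := abs_trace_mul_le M (vecMulVec a a)
  have h1 : (M * vecMulVec a a).trace = a ⬝ᵥ M *ᵥ a := by
    rw [mul_vecMulVec, trace_vecMulVec, dotProduct_comm]
  have h2 : ‖vecMulVec a a‖ = a ⬝ᵥ a := by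
    have h0 : 0 ≤ a ⬝ᵥ a := by simpa using dotProduct_star_self_nonneg a
    rw [← abs_of_nonneg (norm_nonneg (vecMulVec a a)), ← abs_of_nonneg h0, ← sq_eq_sq_iff_abs_eq_abs,
      frobenius_sq, transpose_vecMulVec, vecMulVec_mul_vecMulVec, trace_vecMulVec,
      dotProduct_smul, smul_eq_mul, pow_two]
  rwa [h1, h2] at h

variable {M : Matrix ι ι ℝ}

theorem posDef_one_add (hM : Mᵀ = M) (h : ‖M‖ < 1) : (1 + M).PosDef := by
  refine PosDef.of_dotProduct_mulVec_pos (by simp [IsHermitian, hM]) fun a ha => ?_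
  have h1 := abs_dotProduct_mulVec_le M a
  have h2 : 0 < a ⬝ᵥ a := by simpa using dotProduct_star_self_pos_iff.2 ha
  have h3 := (abs_le.1 h1).1
  simp only [star_trivial, add_mulVec, one_mulVec, dotProduct_add]
  nlinarith

theorem norm_mul_inv_le (hQ : IsUnit (1 + M).det) (h : ‖M‖ < 1) (W : Matrix ι ι ℝ) :
    ‖(1 + M)⁻¹ * W‖ ≤ ‖W‖ / (1 - ‖M‖) := by
  rw [le_div_iff₀ (by linarith)]
  -- With X = (1 + M)⁻¹ W, the identity X = W - M X gives ‖X‖ ≤ ‖W‖ + ‖M‖ ‖X‖; no Neumann series is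
  -- needed.
  have h1 : (1 + M)⁻¹ * W = W - M * ((1 + M)⁻¹ * W) := by
    have h2 : (1 + M) * ((1 + M)⁻¹ * W) = W := mul_nonsing_inv_cancel_left _ _ hQ
    rw [add_mul, one_mul] at h2
    exact eq_sub_of_add_eq h2
  have h3 := norm_sub_le W (M * ((1 + M)⁻¹ * W))
  rw [← h1] at h3
  have h4 := norm_mul_le M ((1 + M)⁻¹ * W)
  nlinarith

theorem trace_inv_mul_inv_mul_le (hM : Mᵀ = M) (h : ‖M‖ < 1) (W : Matrix ι ι ℝ) :
    ((1 + M)⁻¹ * W * (1 + M)⁻¹ * W).trace ≤ (‖W‖ / (1 - ‖M‖)) ^ 2 := by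
  have hQ := (posDef_one_add hM h).det_pos.ne'.isUnit
  have h1 := norm_mul_inv_le hQ h W
  have h2 := abs_trace_mul_le ((1 + M)⁻¹ * W) ((1 + M)⁻¹ * W)
  rw [Matrix.mul_assoc _ (1 + M)⁻¹ W]
  refine (le_abs_self _).trans (h2.trans ?_)
  rw [pow_two]
  gcongr

theorem one_sub_inv (hQ : IsUnit (1 + M).det) : 1 - (1 + M)⁻¹ = (1 + M)⁻¹ * M := by
  have h := nonsing_inv_mul (1 + M) hQ
  rw [mul_add, mul_one] at h
  exact sub_eq_of_eq_add' h.symm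

theorem one_sub_inv' (hQ : IsUnit (1 + M).det) : 1 - (1 + M)⁻¹ = M * (1 + M)⁻¹ := by
  have h := mul_nonsing_inv (1 + M) hQ
  rw [add_mul, one_mul] at h
  exact sub_eq_of_eq_add' h.symm

theorem norm_one_sub_inv_le (hM : Mᵀ = M) (h : ‖M‖ < 1) :
    ‖1 - (1 + M)⁻¹‖ ≤ ‖M‖ / (1 - ‖M‖) := by
  have hQ := (posDef_one_add hM h).det_pos.ne'.isUnit
  rw [one_sub_inv hQ]
  exact norm_mul_inv_le hQ h M

/-- The remainder factors as -M (1 - (1 + M)⁻¹), so one more factor ‖M‖ is gained over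
`norm_one_sub_inv_le`. This is the source of quadratic convergence. -/
theorem norm_newton_remainder_le (hM : Mᵀ = M) (h : ‖M‖ < 1) :
    ‖1 - M - (1 + M)⁻¹‖ ≤ ‖M‖ ^ 2 / (1 - ‖M‖) := by
  have hQ := (posDef_one_add hM h).det_pos.ne'.isUnit
  have h1 : 1 - M - (1 + M)⁻¹ = -(M * (1 - (1 + M)⁻¹)) := by
    rw [mul_sub, mul_one, ← one_sub_inv' hQ]; abel
  rw [h1, norm_neg]
  refine (norm_mul_le _ _).trans ?_
  rw [pow_two, mul_div_assoc]
  exact mul_le_mul_of_nonneg_left (norm_one_sub_inv_le hM h) (norm_nonneg _)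

theorem dotProduct_inv_mulVec_ge {Q : Matrix ι ι ℝ} (hQ : Q.PosDef) {b : ℝ} (hb : 0 < b)
    (h : ∀ a : ι → ℝ, a ⬝ᵥ Q *ᵥ a ≤ b * (a ⬝ᵥ a)) (a : ι → ℝ) :
    a ⬝ᵥ a / b ≤ a ⬝ᵥ Q⁻¹ *ᵥ a := by
  have hu := hQ.det_pos.ne'.isUnit
  have hs : Q⁻¹ᵀ = Q⁻¹ := by simpa using hQ.inv.isHermitian.eq
  -- Expanding the form of Q at Q⁻¹a - a/b and inserting Q ≤ b gives the bound without diagonalizing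
  -- Q.
  have h1 := hQ.posSemidef.dotProduct_mulVec_nonneg (Q⁻¹ *ᵥ a - b⁻¹ • a)
  have h2 : Q *ᵥ (Q⁻¹ *ᵥ a) = a := by rw [mulVec_mulVec, mul_nonsing_inv _ hu, one_mulVec]
  have h3 : (Q⁻¹ *ᵥ a) ⬝ᵥ Q *ᵥ a = a ⬝ᵥ a := by
    rw [← hs, mulVec_transpose, ← dotProduct_mulVec, mulVec_mulVec, nonsing_inv_mul _ hu,
      one_mulVec]
  have h4 : (Q⁻¹ *ᵥ a) ⬝ᵥ a = a ⬝ᵥ Q⁻¹ *ᵥ a := dotProduct_comm _ _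
  simp only [star_trivial, mulVec_sub, mulVec_smul, h2, sub_dotProduct, dotProduct_sub,
    dotProduct_smul, smul_dotProduct, h3, h4, smul_eq_mul] at h1
  have h5 := h a
  have h6 : b⁻¹ * (b⁻¹ * (a ⬝ᵥ Q *ᵥ a)) ≤ b⁻¹ * (b⁻¹ * (b * (a ⬝ᵥ a))) := by gcongr
  rw [inv_mul_cancel_left₀ hb.ne'] at h6
  rw [div_eq_inv_mul]
  linarith

/-- The difference is tr(M (1 + M)⁻¹ M), a sum over the columns of M of the form of (1 + M)⁻¹, and 1
+ M ≤ 1 + ‖M‖. Only positivity of 1 + M is used, not smallness of M. -/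
theorem trace_sub_trace_inv_mul_ge (hM : Mᵀ = M) (hQ : (1 + M).PosDef) :
    ‖M‖ ^ 2 / (1 + ‖M‖) ≤ M.trace - ((1 + M)⁻¹ * M).trace := by
  have hu := hQ.det_pos.ne'.isUnit
  have h0 : 0 < 1 + ‖M‖ := by positivity
  have h1 : M.trace - ((1 + M)⁻¹ * M).trace = (M * (1 + M)⁻¹ * M).trace := by
    rw [← trace_sub, ← one_sub_inv' hu, sub_mul, one_mul]
  have h2 := fun a => dotProduct_inv_mulVec_ge hQ h0 (fun a => by
    have := (abs_le.1 (abs_dotProduct_mulVec_le M a)).2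
    simp only [add_mulVec, one_mulVec, dotProduct_add]
    linarith) a
  have h3 : ∀ K : Matrix ι ι ℝ, (M * K * M).trace = ∑ j, (Mᵀ j) ⬝ᵥ K *ᵥ (Mᵀ j) := by
    intro K
    rw [Matrix.trace]
    refine Finset.sum_congr rfl fun j _ => ?_
    rw [Matrix.diag_apply, Matrix.mul_assoc]
    rw [Matrix.mul_apply', show M j = Mᵀ j by rw [hM]]
    rfl
  rw [h1, frobenius_sq, hM, h3]
  have h4 := h3 1
  rw [mul_one] at h4
  rw [h4, Finset.sum_div]
  refine Finset.sum_le_sum fun j _ => ?_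
  rw [one_mulVec]
  exact h2 (Mᵀ j)

end Frobenius

/-! ### Derivatives of log det and of the matrix inverse -/

section LogDet

open Matrix

attribute [local instance] Matrix.frobeniusNormedRing Matrix.frobeniusNormedAlgebra

variable {ι : Type*} [Fintype ι] [DecidableEq ι]

theorem differentiable_det : Differentiable ℝ (fun X : Matrix ι ι ℝ => X.det) := by
  have h (i j : ι) : Differentiable ℝ (fun X : Matrix ι ι ℝ => X i j) :=
    (LinearMap.toContinuousLinearMap (Matrix.entryLinearMap ℝ ℝ i j)).differentiable
  simp only [det_apply]
  fun_prop

theorem hasDerivAt_det_line {X : Matrix ι ι ℝ} (hX : IsUnit X.det) (V : Matrix ι ι ℝ) :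
    HasDerivAt (fun s : ℝ => (X + s • V).det) (X.det * (X⁻¹ * V).trace) 0 := by
  -- P collects the terms of order at least two in det(1 + s X⁻¹V), divided by s²; they do not
  -- affect the derivative at 0.
  set P : Polynomial ℝ := (det (1 + (Polynomial.X : Polynomial ℝ) •
    (X⁻¹ * V).map Polynomial.C)).divX.divX with hP
  have h (s : ℝ) : (X + s • V).det = X.det * (1 + (X⁻¹ * V).trace * s + P.eval s * s ^ 2) := by
    rw [hP, ← det_one_add_smul s (X⁻¹ * V), ← det_mul, mul_add, mul_one, mul_smul_comm,
      mul_nonsing_inv_cancel_left _ _ hX]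
  simp only [h]
  have h1 : HasDerivAt (fun s : ℝ => P.eval s) (P.derivative.eval 0) 0 := P.hasDerivAt 0
  have h2 := (((hasDerivAt_id (0 : ℝ)).const_mul (X⁻¹ * V).trace).const_add 1).add
    (h1.mul ((hasDerivAt_id (0 : ℝ)).pow 2))
  have h3 := h2.const_mul X.det
  refine (h3.congr_deriv ?_)
  simp

theorem hasFDerivAt_log_det {X : Matrix ι ι ℝ} (hX : IsUnit X.det) :
    HasFDerivAt (fun X : Matrix ι ι ℝ => Real.log X.det) (LinearMap.toContinuousLinearMap
      (traceLinearMap ι ℝ ℝ ∘ₗ LinearMap.mulLeft ℝ X⁻¹)) X := by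
  have h := (differentiable_det X).hasFDerivAt
  have h1 := h.log hX.ne_zero
  refine h1.congr_fderiv ?_
  -- Differentiability is known, so the derivative is determined by its values along lines.
  ext V
  have h2 : HasDerivAt (fun s : ℝ => X + s • V) V 0 :=
    (((hasDerivAt_id (0 : ℝ)).smul_const V).const_add X).congr_deriv (one_smul ℝ V)
  have h3 : HasDerivAt (fun s : ℝ => (X + s • V).det) _ 0 :=
    HasFDerivAt.comp_hasDerivAt_of_eq (0 : ℝ) h h2 (by simp)
  have h4 := h3.unique (hasDerivAt_det_line hX V)
  exact (congrArg (X.det⁻¹ * ·) h4).trans (inv_mul_cancel_left₀ hX.ne_zero _)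

theorem hasFDerivAt_matrix_inv {X : Matrix ι ι ℝ} (hX : IsUnit X.det) :
    HasFDerivAt (fun X : Matrix ι ι ℝ => X⁻¹)
      (-ContinuousLinearMap.mulLeftRight ℝ (Matrix ι ι ℝ) X⁻¹ X⁻¹) X := by
  have hu : IsUnit X := (isUnit_iff_isUnit_det X).2 hX
  have h := hasFDerivAt_ringInverse (𝕜 := ℝ) hu.unit
  have h1 : (↑hu.unit⁻¹ : Matrix ι ι ℝ) = X⁻¹ := by
    rw [coe_units_inv]; rfl
  rw [h1] at h
  simp only [nonsing_inv_eq_ringInverse] at h ⊢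
  exact h

end LogDet

/-! ### The map Λ, its adjoint, and the gradient and Hessian of the barrier -/

namespace WSOS

open Matrix

attribute [local instance] Matrix.frobeniusNormedRing Matrix.frobeniusNormedAlgebra

variable {n m : ℕ} (D : WSOS n m)

/-- `Λ` as a linear map. -/
noncomputable def lamLin : D.E →ₗ[ℝ] Matrix (Σ i, Fin (D.L i)) (Σ i, Fin (D.L i)) ℝ where
  toFun := D.LamSum
  map_add' x y := by
    rw [LamSum, LamSum, LamSum, ← blockDiagonal'_add]
    congr 1
    ext i j k
    simp [Lam, mul_add, Finset.sum_add_distrib]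
  map_smul' c x := by
    rw [LamSum, LamSum, RingHom.id_apply, ← blockDiagonal'_smul]
    congr 1
    ext i j k
    simp [Lam, Finset.mul_sum, mul_left_comm]

@[simp] theorem lamLin_apply (x : D.E) : D.lamLin x = D.LamSum x := rfl

theorem lam_transpose (i : Fin m) (x : D.E) : (D.Lam i x)ᵀ = D.Lam i x := by
  ext j k
  simp only [Lam, transpose_apply, of_apply, mul_comm (D.p i k : MvPolynomial (Fin n) ℝ)]

theorem lamSum_transpose (x : D.E) : (D.LamSum x)ᵀ = D.LamSum x := by
  rw [LamSum, blockDiagonal'_transpose]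
  simp only [lam_transpose]

/-- The adjoint of `Λ` for the trace pairing. -/
noncomputable def adj : Matrix (Σ i, Fin (D.L i)) (Σ i, Fin (D.L i)) ℝ →ₗ[ℝ] D.E where
  toFun S := WithLp.toLp 2 fun u => (S * D.LamSum (EuclideanSpace.single u 1)).trace
  map_add' S T := by ext u; simp [add_mul]
  map_smul' c S := by ext u; simp

theorem inner_adj (S : Matrix (Σ i, Fin (D.L i)) (Σ i, Fin (D.L i)) ℝ) (x : D.E) :
    inner ℝ (D.adj S) x = (S * D.LamSum x).trace := by
  have h : x = ∑ u, x u • (EuclideanSpace.single u 1 : D.E) := by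
    ext v
    simp [Pi.single_apply]
  conv_rhs => rw [h, ← lamLin_apply, map_sum, Finset.mul_sum, trace_sum]
  simp [adj, PiLp.inner_apply]

theorem hasGradientAt_barrier {x : D.E} (hx : (D.LamSum x).PosDef) :
    HasGradientAt D.barrier (-D.adj (D.LamSum x)⁻¹) x := by
  have h := ((hasFDerivAt_log_det hx.det_pos.ne'.isUnit).comp x
    (LinearMap.toContinuousLinearMap D.lamLin).hasFDerivAt).neg
  rw [hasGradientAt_iff_hasFDerivAt]
  refine HasFDerivAt.congr_fderiv (f := D.barrier) h ?_
  ext v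
  rw [InnerProductSpace.toDual_apply_apply, inner_neg_left, inner_adj]
  rfl

theorem grad_eq {x : D.E} (hx : (D.LamSum x).PosDef) : D.grad x = -D.adj (D.LamSum x)⁻¹ :=
  (D.hasGradientAt_barrier hx).gradient

theorem continuous_lamSum : Continuous D.LamSum :=
  (LinearMap.toContinuousLinearMap D.lamLin).continuous

theorem isOpen_posDef : IsOpen {x : D.E | (D.LamSum x).PosDef} := by
  rw [isOpen_iff_mem_nhds]
  intro x hx
  -- An upper bound for the form of Λ(x)⁻¹ is a lower bound 1/b for that of Λ(x); a Frobenius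
  -- perturbation smaller than 1/b cannot destroy it.
  obtain ⟨b, hb, hbx⟩ : ∃ b : ℝ, 0 < b ∧
      ∀ a : (Σ i, Fin (D.L i)) → ℝ, a ⬝ᵥ a / b ≤ a ⬝ᵥ D.LamSum x *ᵥ a := by
    refine ⟨1 + ‖(D.LamSum x)⁻¹‖, by positivity, fun a => ?_⟩
    have h := dotProduct_inv_mulVec_ge hx.inv (b := 1 + ‖(D.LamSum x)⁻¹‖) (by positivity)
      (fun a => by
        have h1 := (abs_le.1 (abs_dotProduct_mulVec_le (D.LamSum x)⁻¹ a)).2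
        have h0 : 0 ≤ a ⬝ᵥ a := by simpa using dotProduct_star_self_nonneg a
        linarith) a
    rwa [nonsing_inv_nonsing_inv _ hx.det_pos.ne'.isUnit] at h
  have hc : Tendsto (fun z => ‖D.LamSum z - D.LamSum x‖) (𝓝 x) (𝓝 0) := by
    have h := ((D.continuous_lamSum.sub continuous_const).norm : Continuous fun z =>
      ‖D.LamSum z - D.LamSum x‖).tendsto x
    simpa using h
  filter_upwards [hc.eventually (gt_mem_nhds (inv_pos.2 hb))] with z hz
  refine PosDef.of_dotProduct_mulVec_pos (by
    rw [IsHermitian, conjTranspose_eq_transpose_of_trivial, lamSum_transpose]) fun a ha => ?_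
  have h1 := (abs_le.1 (abs_dotProduct_mulVec_le (D.LamSum z - D.LamSum x) a)).1
  have h2 : 0 < a ⬝ᵥ a := by simpa using dotProduct_star_self_pos_iff.2 ha
  have h3 := hbx a
  rw [sub_mulVec, dotProduct_sub] at h1
  rw [div_eq_inv_mul] at h3
  simp only [star_trivial]
  nlinarith

theorem hess_apply {x : D.E} (hx : (D.LamSum x).PosDef) (v : D.E) :
    D.hess x v = D.adj ((D.LamSum x)⁻¹ * D.LamSum v * (D.LamSum x)⁻¹) := by
  have h := ((LinearMap.toContinuousLinearMap D.adj).hasFDerivAt.comp x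
    ((hasFDerivAt_matrix_inv hx.det_pos.ne'.isUnit).comp x
      (LinearMap.toContinuousLinearMap D.lamLin).hasFDerivAt)).neg
  have h1 : HasFDerivAt D.grad _ x := h.congr_of_eventuallyEq (by
    filter_upwards [D.isOpen_posDef.mem_nhds hx] with z hz
    rw [D.grad_eq hz]
    rfl)
  rw [hess, h1.fderiv]
  change -(D.adj (-((D.LamSum x)⁻¹ * D.LamSum v * (D.LamSum x)⁻¹))) = _
  rw [map_neg, neg_neg]

end WSOS

/-! ### Positive semidefinite and block diagonal matrices -/

section Blocks

open Matrix

attribute [local instance] Matrix.frobeniusNormedRing Matrix.frobeniusNormedAlgebra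

theorem posSemidef_transpose_mul_self {ι : Type*} [Fintype ι] (B : Matrix ι ι ℝ) :
    (Bᵀ * B).PosSemidef := by
  simpa using posSemidef_conjTranspose_mul_self B

variable {ι : Type*} [Fintype ι] [DecidableEq ι]

theorem Matrix.PosSemidef.exists_eq_transpose_mul_self {S : Matrix ι ι ℝ} (hS : S.PosSemidef) :
    ∃ B : Matrix ι ι ℝ, S = Bᵀ * B := by
  open scoped MatrixOrder in
  obtain ⟨B, hB⟩ := CStarAlgebra.nonneg_iff_eq_star_mul_self.1 (nonneg_iff_posSemidef.2 hS)
  exact ⟨B, by simpa [star_eq_conjTranspose] using hB⟩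

variable {κ : ι → Type*} [∀ i, Fintype (κ i)]

theorem dotProduct_blockDiagonal'_mulVec (M : ∀ i, Matrix (κ i) (κ i) ℝ) (a : (Σ i, κ i) → ℝ) :
    a ⬝ᵥ blockDiagonal' M *ᵥ a =
      ∑ i, (fun j => a ⟨i, j⟩) ⬝ᵥ M i *ᵥ (fun j => a ⟨i, j⟩) := by
  simp only [dotProduct, mulVec, Fintype.sum_sigma]
  refine Finset.sum_congr rfl fun i _ => Finset.sum_congr rfl fun j _ => ?_
  congr 1
  rw [Finset.sum_eq_single i]
  · simp
  · intro i' _ h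
    simp [blockDiagonal'_apply_ne M _ _ h.symm]
  · simp

theorem posSemidef_blockDiagonal' {M : ∀ i, Matrix (κ i) (κ i) ℝ} (h : ∀ i, (M i).PosSemidef) :
    (blockDiagonal' M).PosSemidef := by
  refine PosSemidef.of_dotProduct_mulVec_nonneg ?_ fun a => ?_
  · rw [IsHermitian, blockDiagonal'_conjTranspose]
    congr 1
    funext i
    exact (h i).1
  · rw [star_trivial, dotProduct_blockDiagonal'_mulVec]
    exact Finset.sum_nonneg fun i _ => by
      simpa using (h i).dotProduct_mulVec_nonneg (fun j => a ⟨i, j⟩)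

theorem trace_mul_blockDiagonal' (S : Matrix (Σ i, κ i) (Σ i, κ i) ℝ)
    (M : ∀ i, Matrix (κ i) (κ i) ℝ) :
    (S * blockDiagonal' M).trace = ∑ i, ∑ j, ∑ k, S ⟨i, j⟩ ⟨i, k⟩ * M i k j := by
  simp only [Matrix.trace, Matrix.mul_apply, Matrix.diag_apply, Fintype.sum_sigma]
  refine Finset.sum_congr rfl fun i _ => Finset.sum_congr rfl fun j _ => ?_
  rw [Finset.sum_eq_single i]
  · simp
  · intro i' _ h
    simp [blockDiagonal'_apply_ne M _ _ h]
  · simp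

end Blocks

/-- A small step from s in the direction -z stays in K and must still pair nonnegatively with z. -/
theorem exists_pos_mul_norm_le_inner {V : Type*} [NormedAddCommGroup V] [InnerProductSpace ℝ V]
    {K : Set V} {s : V} (hs : s ∈ interior K) :
    ∃ ε : ℝ, 0 < ε ∧ ∀ z : V, (∀ k ∈ K, 0 ≤ inner ℝ k z) → ε * ‖z‖ ≤ inner ℝ s z := by
  obtain ⟨ε, hε, hb⟩ := Metric.isOpen_iff.1 isOpen_interior s hs
  refine ⟨ε / 2, by positivity, fun z hz => ?_⟩
  rcases eq_or_ne z 0 with rfl | h0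
  · simp
  have hn : 0 < ‖z‖ := norm_pos_iff.2 h0
  have h := hz (s - (ε / 2 / ‖z‖) • z) (interior_subset (hb (by
    rw [Metric.mem_ball, dist_eq_norm, sub_sub_cancel_left, norm_neg, norm_smul, Real.norm_eq_abs,
      abs_of_pos (by positivity), div_mul_cancel₀ _ hn.ne']
    linarith)))
  rw [inner_sub_left, inner_smul_left, real_inner_self_eq_norm_sq] at h
  have h1 : ε / 2 / ‖z‖ * ‖z‖ ^ 2 = ε / 2 * ‖z‖ := by field_simp
  simp only [conj_trivial] at h
  linarith

/-! ### Σ and Σ* in terms of semidefinite matrices -/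

namespace WSOS

open Matrix

attribute [local instance] Matrix.frobeniusNormedRing Matrix.frobeniusNormedAlgebra

variable {n m : ℕ} (D : WSOS n m)

theorem poly_eq (s : D.E) : D.poly s = (D.q.equivFun.symm s : MvPolynomial (Fin n) ℝ) := by
  rw [Module.Basis.equivFun_symm_apply, poly]
  simp

theorem poly_injective : Function.Injective D.poly := by
  intro s t h
  rw [poly_eq, poly_eq] at h
  have h1 := D.q.equivFun.symm.injective (Subtype.ext h)
  ext u
  exact congrFun h1 u

/-- The Gram matrix description of Σ rests on this identity. Off-diagonal blocks of S disappear
because Λ is block diagonal. -/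
theorem poly_adj (S : Matrix (Σ i, Fin (D.L i)) (Σ i, Fin (D.L i)) ℝ) :
    D.poly (D.adj S) = ∑ i, D.w i * ∑ j, ∑ k, S ⟨i, j⟩ ⟨i, k⟩ •
      ((D.p i j : MvPolynomial (Fin n) ℝ) * (D.p i k : MvPolynomial (Fin n) ℝ)) := by
  have h : (D.adj S : D.E).ofLp = D.q.equivFun (∑ i, ∑ j, ∑ k, S ⟨i, j⟩ ⟨i, k⟩ •
      ⟨_, weight_mul_mem_wsosSpace D.w D.d i (D.p i j) (D.p i k)⟩) := by
    ext u
    change (S * D.LamSum (EuclideanSpace.single u 1)).trace = _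
    rw [LamSum, trace_mul_blockDiagonal']
    simp only [map_sum, map_smul, Finset.sum_apply, Pi.smul_apply, smul_eq_mul]
    refine Finset.sum_congr rfl fun i _ => Finset.sum_congr rfl fun j _ =>
      Finset.sum_congr rfl fun k _ => ?_
    rw [← D.lam_transpose]
    simp [Lam]
  rw [poly_eq, h, LinearEquiv.symm_apply_apply]
  simp [Finset.mul_sum]

theorem adj_mem_cone {S : Matrix (Σ i, Fin (D.L i)) (Σ i, Fin (D.L i)) ℝ} (hS : S.PosSemidef) :
    D.adj S ∈ D.cone := by
  obtain ⟨B, rfl⟩ := hS.exists_eq_transpose_mul_self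
  refine ⟨_, fun i => ?_, D.poly_adj _⟩
  -- With S = BᵀB, each row of B, cut down to the columns of block i, is the coefficient vector of
  -- one square in σ i.
  let φ := (Fintype.equivFin (Σ i, Fin (D.L i))).symm
  refine ⟨_, fun l => ∑ j, B (φ l) ⟨i, j⟩ • (D.p i j : MvPolynomial (Fin n) ℝ), fun l => ?_, ?_⟩
  · exact Submodule.sum_mem _ fun j _ => Submodule.smul_mem _ _ (D.p i j).2
  · rw [φ.sum_comp (fun a => (∑ j, B a ⟨i, j⟩ • (D.p i j : MvPolynomial (Fin n) ℝ)) ^ 2)]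
    simp only [pow_two, Finset.sum_mul_sum, smul_mul_smul_comm, Matrix.mul_apply, transpose_apply,
      Finset.sum_smul]
    rw [Finset.sum_comm' (t' := Finset.univ) (s' := fun _ => Finset.univ) (by simp)]
    conv_rhs => rw [Finset.sum_comm]
    rw [Finset.sum_comm]
    refine Finset.sum_congr rfl fun j _ => ?_
    rw [Finset.sum_comm]

theorem mem_cone_iff {s : D.E} : s ∈ D.cone ↔
    ∃ S : Matrix (Σ i, Fin (D.L i)) (Σ i, Fin (D.L i)) ℝ, S.PosSemidef ∧ s = D.adj S := by
  refine ⟨?_, fun ⟨S, hS, h⟩ => h ▸ D.adj_mem_cone hS⟩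
  rintro ⟨σ, hσ, hs⟩
  choose l h hh hsum using hσ
  let a (i : Fin m) (b : Fin (l i)) : Fin (D.L i) → ℝ := (D.p i).equivFun ⟨h i b, hh i b⟩
  have ha (i : Fin m) (b : Fin (l i)) :
      h i b = ∑ j, a i b j • (D.p i j : MvPolynomial (Fin n) ℝ) := by
    have h1 := congrArg Subtype.val ((D.p i).sum_equivFun ⟨h i b, hh i b⟩)
    refine h1.symm.trans ?_
    simp only [a, Submodule.coe_sum, Submodule.coe_smul]
  refine ⟨blockDiagonal' fun i => ∑ b, vecMulVec (a i b) (a i b),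
    posSemidef_blockDiagonal' fun i => posSemidef_sum _ fun b _ => ?_, D.poly_injective ?_⟩
  · simpa using posSemidef_vecMulVec_self_star (a i b)
  · rw [hs, poly_adj]
    refine Finset.sum_congr rfl fun i _ => ?_
    rw [hsum i]
    congr 1
    simp only [ha, pow_two, Finset.sum_mul_sum, smul_mul_smul_comm, blockDiagonal'_apply_eq,
      Matrix.sum_apply, vecMulVec_apply, Finset.sum_smul]
    rw [Finset.sum_comm]
    refine Finset.sum_congr rfl fun j _ => ?_
    rw [Finset.sum_comm]

/-- Testing against `D.adj` of a aᵀ gives one direction; tr(BᵀB Λ(x)) = tr(B Λ(x) Bᵀ) gives the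
other. -/
theorem mem_dualCone_iff {x : D.E} : x ∈ D.dualCone ↔ (D.LamSum x).PosSemidef := by
  constructor
  · intro hx
    refine PosSemidef.of_dotProduct_mulVec_nonneg (by
      rw [IsHermitian, conjTranspose_eq_transpose_of_trivial, lamSum_transpose]) fun a => ?_
    have h := hx _ (D.adj_mem_cone (by simpa using posSemidef_vecMulVec_self_star a))
    rwa [inner_adj, vecMulVec_mul, trace_vecMulVec, dotProduct_comm, ← dotProduct_mulVec] at h
  · intro hx s hs
    obtain ⟨S, hS, rfl⟩ := D.mem_cone_iff.1 hs
    obtain ⟨B, rfl⟩ := hS.exists_eq_transpose_mul_self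
    rw [inner_adj, Matrix.mul_assoc, trace_mul_comm]
    simpa using (hx.mul_mul_conjTranspose_same B).trace_nonneg

theorem exists_pos_mul_norm_le_inner_of_mem_interior {y : D.E} (hy : y ∈ interior D.dualCone) :
    ∃ ε : ℝ, 0 < ε ∧ ∀ s ∈ D.cone, ε * ‖s‖ ≤ inner ℝ s y := by
  obtain ⟨ε, hε, h⟩ := exists_pos_mul_norm_le_inner hy
  refine ⟨ε, hε, fun s hs => ?_⟩
  rw [real_inner_comm]
  exact h s fun k hk => by
    rw [real_inner_comm]
    exact hk s hs

/-- The form is the pairing of y with the element w i (∑ b j p i j)² of Σ. An interior y pairs to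
zero only with zero, so the square vanishes because w i ≠ 0 in an integral domain, and then b = 0 by
independence of p i. -/
theorem eq_zero_of_lam_form_eq_zero {y : D.E} (hy : y ∈ interior D.dualCone) {i : Fin m}
    {b : Fin (D.L i) → ℝ} (h : b ⬝ᵥ D.Lam i y *ᵥ b = 0) : b = 0 := by
  let S : Matrix (Σ i, Fin (D.L i)) (Σ i, Fin (D.L i)) ℝ :=
    blockDiagonal' (Pi.single (M := fun i => Matrix (Fin (D.L i)) (Fin (D.L i)) ℝ) i
      (vecMulVec b b))
  have hS : S.PosSemidef := posSemidef_blockDiagonal' fun i' => by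
    rcases eq_or_ne i' i with rfl | hi
    · simpa using posSemidef_vecMulVec_self_star b
    · simpa [Pi.single_eq_of_ne hi] using PosSemidef.zero
  have hin : inner ℝ (D.adj S) y = 0 := by
    rw [inner_adj, LamSum, ← blockDiagonal'_mul, trace_blockDiagonal',
      Finset.sum_eq_single i (fun i' _ hi => by simp [Pi.single_eq_of_ne hi]) (by simp),
      Pi.single_eq_same, vecMulVec_mul, trace_vecMulVec, dotProduct_comm, ← dotProduct_mulVec, h]
  obtain ⟨ε, hε, hle⟩ := D.exists_pos_mul_norm_le_inner_of_mem_interior hy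
  have h0 : D.adj S = 0 := by
    have := hle _ (D.adj_mem_cone hS)
    rw [hin] at this
    rw [← norm_le_zero_iff]
    nlinarith [norm_nonneg (D.adj S)]
  have h1 := D.poly_adj S
  rw [h0, Finset.sum_eq_single i (fun i' _ hi => by simp [S, Pi.single_eq_of_ne hi]) (by simp)] at h1
  have h2 : (∑ j, ∑ k, S ⟨i, j⟩ ⟨i, k⟩ • ((D.p i j : MvPolynomial (Fin n) ℝ) *
      (D.p i k : MvPolynomial (Fin n) ℝ))) =
      (∑ j, b j • (D.p i j : MvPolynomial (Fin n) ℝ)) ^ 2 := by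
    simp only [S, blockDiagonal'_apply_eq, Pi.single_eq_same, pow_two, Finset.sum_mul_sum,
      smul_mul_smul_comm, vecMulVec_apply]
  have h3 : ∑ j, b j • (D.p i j : MvPolynomial (Fin n) ℝ) = 0 := by
    rw [h2] at h1
    simpa [poly, D.w_ne_zero i] using h1.symm
  have h4 : ∑ j, b j • D.p i j = 0 := Subtype.ext (by simpa using h3)
  funext j
  exact Fintype.linearIndependent_iff.1 (D.p i).linearIndependent b h4 j

theorem mem_interior_dualCone_iff {x : D.E} :
    x ∈ interior D.dualCone ↔ (D.LamSum x).PosDef := by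
  constructor
  · intro hx
    have hp := D.mem_dualCone_iff.1 (interior_subset hx)
    have hb (i : Fin m) (b : Fin (D.L i) → ℝ) : 0 ≤ b ⬝ᵥ D.Lam i x *ᵥ b := by
      have h := hp.dotProduct_mulVec_nonneg (fun z => Sigma.casesOn z
        (Pi.single (M := fun i => Fin (D.L i) → ℝ) i b))
      rw [star_trivial, LamSum, dotProduct_blockDiagonal'_mulVec, Finset.sum_eq_single i] at h
      · simpa using h
      · intro i' _ hi
        simp [Pi.single_eq_of_ne hi, dotProduct]
      · simp
    refine PosDef.of_dotProduct_mulVec_pos hp.1 fun a ha => ?_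
    rw [star_trivial, LamSum, dotProduct_blockDiagonal'_mulVec]
    obtain ⟨⟨i, j⟩, hij⟩ := Function.ne_iff.1 ha
    refine Finset.sum_pos' (fun i _ => hb i _) ⟨i, Finset.mem_univ _, (hb i _).lt_of_ne' ?_⟩
    intro h0
    exact hij (congrFun (D.eq_zero_of_lam_form_eq_zero hx h0) j)
  · intro hx
    exact mem_interior.2 ⟨_, fun z hz => D.mem_dualCone_iff.2 (PosDef.posSemidef hz),
      D.isOpen_posDef, hx⟩

theorem smul_mem_cone {s : D.E} (hs : s ∈ D.cone) {a : ℝ} (ha : 0 ≤ a) : a • s ∈ D.cone := by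
  obtain ⟨S, hS, rfl⟩ := D.mem_cone_iff.1 hs
  rw [← map_smul]
  exact D.adj_mem_cone (hS.smul ha)

/-- A kernel vector of Λ is orthogonal to all of Σ, which has an interior point. This injectivity
makes H(x) positive definite. -/
theorem eq_zero_of_lamSum_eq_zero {e : D.E} (he : e ∈ interior D.cone) {v : D.E}
    (hv : D.LamSum v = 0) : v = 0 := by
  obtain ⟨ε, hε, h⟩ := exists_pos_mul_norm_le_inner he
  have h0 (s : D.E) (hs : s ∈ D.cone) : inner ℝ s v = 0 := by
    obtain ⟨S, -, rfl⟩ := D.mem_cone_iff.1 hs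
    rw [inner_adj, hv, mul_zero, trace_zero]
  have h1 := h v fun k hk => (h0 k hk).ge
  rw [h0 e (interior_subset he)] at h1
  rw [← norm_le_zero_iff]
  nlinarith [norm_nonneg v]

/-- A linear image of a closed cone need not be closed. Here an interior point y of Σ* bounds the
factor B of S = BᵀB by the pairing with y, so a truncation of Σ lies in a compact image. -/
theorem isClosed_cone (hdual : (interior D.dualCone).Nonempty) : IsClosed D.cone := by
  obtain ⟨y, hy⟩ := hdual
  have hpd := D.mem_interior_dualCone_iff.1 hy
  obtain ⟨b, hb, hby⟩ : ∃ b : ℝ, 0 < b ∧ ∀ B : Matrix (Σ i, Fin (D.L i)) (Σ i, Fin (D.L i)) ℝ,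
      ‖B‖ ^ 2 ≤ b * inner ℝ (D.adj (Bᵀ * B)) y := by
    obtain ⟨C, hC⟩ := hpd.posSemidef.exists_eq_transpose_mul_self
    have hCu : IsUnit C.det := by
      have h := hpd.det_pos.ne'
      rw [hC, det_mul] at h
      exact (right_ne_zero_of_mul h).isUnit
    -- The pairing equals ‖B Cᵀ‖², and B is recovered by multiplying by C⁻ᵀ. The summand 1 only
    -- keeps b positive.
    refine ⟨‖C⁻¹‖ ^ 2 + 1, by positivity, fun B => ?_⟩
    have h1 : inner ℝ (D.adj (Bᵀ * B)) y = ‖B * Cᵀ‖ ^ 2 := by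
      rw [inner_adj, frobenius_sq, hC, transpose_mul, transpose_transpose, Matrix.mul_assoc,
        trace_mul_comm]
      simp only [Matrix.mul_assoc]
    have h2 : ‖B‖ ≤ ‖B * Cᵀ‖ * ‖C⁻¹‖ := by
      rw [← frobenius_transpose C⁻¹]
      refine le_trans (le_of_eq ?_) (norm_mul_le (B * Cᵀ) C⁻¹ᵀ)
      rw [Matrix.mul_assoc, ← transpose_mul, nonsing_inv_mul _ hCu, transpose_one, mul_one]
    rw [h1]
    calc ‖B‖ ^ 2 ≤ (‖B * Cᵀ‖ * ‖C⁻¹‖) ^ 2 := by gcongr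
      _ ≤ _ := by nlinarith [sq_nonneg ‖B * Cᵀ‖]
  refine isClosed_of_closure_subset fun s hs => ?_
  set R := √(b * (inner ℝ s y + 1))
  have hK : IsCompact ((fun B : Matrix (Σ i, Fin (D.L i)) (Σ i, Fin (D.L i)) ℝ =>
      D.adj (Bᵀ * B)) '' Metric.closedBall 0 R) := by
    have := FiniteDimensional.proper ℝ (Matrix (Σ i, Fin (D.L i)) (Σ i, Fin (D.L i)) ℝ)
    refine (isCompact_closedBall _ _).image ?_
    have h1 : Continuous D.adj := (LinearMap.toContinuousLinearMap D.adj).continuous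
    have h2 : Continuous (fun B : Matrix (Σ i, Fin (D.L i)) (Σ i, Fin (D.L i)) ℝ => Bᵀ * B) :=
      Continuous.matrix_mul (continuous_id.matrix_transpose) continuous_id
    exact h1.comp h2
  have hO : IsOpen {z : D.E | inner ℝ z y < inner ℝ s y + 1} :=
    isOpen_lt (by fun_prop) continuous_const
  have h1 : s ∈ closure ({z : D.E | inner ℝ z y < inner ℝ s y + 1} ∩ D.cone) :=
    hO.inter_closure ⟨by simp, hs⟩
  have hsub : {z : D.E | inner ℝ z y < inner ℝ s y + 1} ∩ D.cone ⊆
      (fun B : Matrix (Σ i, Fin (D.L i)) (Σ i, Fin (D.L i)) ℝ =>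
        D.adj (Bᵀ * B)) '' Metric.closedBall 0 R := by
    intro z hz
    obtain ⟨S, hS, hzS⟩ := D.mem_cone_iff.1 hz.2
    obtain ⟨B, rfl⟩ := hS.exists_eq_transpose_mul_self
    refine ⟨B, ?_, hzS.symm⟩
    rw [mem_closedBall_zero_iff]
    refine Real.le_sqrt_of_sq_le ((hby B).trans ?_)
    rw [← hzS]
    exact mul_le_mul_of_nonneg_left (le_of_lt hz.1) hb.le
  obtain ⟨B, -, rfl⟩ := hK.isClosed.closure_subset_iff.2 hsub h1
  exact D.adj_mem_cone (posSemidef_transpose_mul_self B)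

end WSOS

/-! ### Local norms, self-concordance estimates and homogeneity -/

namespace WSOS

open Matrix

attribute [local instance] Matrix.frobeniusNormedRing Matrix.frobeniusNormedAlgebra

variable {n m : ℕ} (D : WSOS n m)

/-- `T` is a congruence transform of `Λ` which sends `x` to the identity matrix. -/
structure IsScaling (x : D.E)
    (T : D.E →ₗ[ℝ] Matrix (Σ i, Fin (D.L i)) (Σ i, Fin (D.L i)) ℝ) : Prop where
  symm : ∀ v, (T v)ᵀ = T v
  map_self : T x = 1
  mem_interior : ∀ z, z ∈ interior D.dualCone ↔ (T z).PosDef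
  mem_dualCone : ∀ z, z ∈ D.dualCone ↔ (T z).PosSemidef
  inner_grad : ∀ z ∈ interior D.dualCone, ∀ u, inner ℝ (D.grad z) u = -((T z)⁻¹ * T u).trace
  inner_hess : ∀ z ∈ interior D.dualCone, ∀ u v,
    inner ℝ u (D.hess z v) = ((T z)⁻¹ * T v * (T z)⁻¹ * T u).trace
  eq_zero : ∀ v, T v = 0 → D.LamSum v = 0

/-- With Λ(x) = CᵀC take T = C⁻ᵀ Λ C⁻¹. Then (T z)⁻¹ T v is conjugate to Λ(z)⁻¹ Λ(v), so the traces
giving g and H do not change. -/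
theorem exists_isScaling {x : D.E} (hx : x ∈ interior D.dualCone) : ∃ T, D.IsScaling x T := by
  have hpd := D.mem_interior_dualCone_iff.1 hx
  obtain ⟨C, hC⟩ := hpd.posSemidef.exists_eq_transpose_mul_self
  have hu : IsUnit C.det := by
    have h := hpd.det_pos.ne'
    rw [hC, det_mul] at h
    exact (right_ne_zero_of_mul h).isUnit
  have huT : IsUnit Cᵀ.det := by rwa [det_transpose]
  have hCi : IsUnit C⁻¹ := (isUnit_iff_isUnit_det _).2 (isUnit_nonsing_inv_det _ hu)
  let T : D.E →ₗ[ℝ] Matrix (Σ i, Fin (D.L i)) (Σ i, Fin (D.L i)) ℝ :=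
    LinearMap.mulLeft ℝ (C⁻¹)ᵀ ∘ₗ LinearMap.mulRight ℝ C⁻¹ ∘ₗ D.lamLin
  have hT (v : D.E) : T v = (C⁻¹)ᵀ * D.LamSum v * C⁻¹ := by
    rw [Matrix.mul_assoc]; rfl
  have hT' (v : D.E) : T v = star C⁻¹ * D.LamSum v * C⁻¹ := by
    rw [hT, star_eq_conjTranspose, conjTranspose_eq_transpose_of_trivial]
  have hinv (z : D.E) : (T z)⁻¹ = C * (D.LamSum z)⁻¹ * Cᵀ := by
    rw [hT, Matrix.mul_inv_rev, Matrix.mul_inv_rev, nonsing_inv_nonsing_inv _ hu,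
      transpose_nonsing_inv, nonsing_inv_nonsing_inv _ huT, Matrix.mul_assoc]
  have hcancel (z v : D.E) : (T z)⁻¹ * T v = C * ((D.LamSum z)⁻¹ * D.LamSum v) * C⁻¹ := by
    rw [hinv, hT, transpose_nonsing_inv]
    simp only [Matrix.mul_assoc]
    rw [mul_nonsing_inv_cancel_left _ _ huT]
  have hconj (K : Matrix (Σ i, Fin (D.L i)) (Σ i, Fin (D.L i)) ℝ) :
      (C * K * C⁻¹).trace = K.trace := by
    rw [trace_mul_comm, ← Matrix.mul_assoc, nonsing_inv_mul _ hu, one_mul]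
  refine ⟨T, ?_, ?_, ?_, ?_, ?_, ?_, ?_⟩
  · intro v
    rw [hT]
    simp [transpose_mul, lamSum_transpose, Matrix.mul_assoc]
  · rw [hT, hC, transpose_nonsing_inv, Matrix.mul_assoc, Matrix.mul_assoc, mul_nonsing_inv _ hu,
      mul_one, nonsing_inv_mul _ huT]
  · intro z
    rw [mem_interior_dualCone_iff, hT', hCi.posDef_star_left_conjugate_iff]
  · intro z
    rw [mem_dualCone_iff, hT', hCi.posSemidef_star_left_conjugate_iff]
  · intro z hz u
    rw [D.grad_eq (D.mem_interior_dualCone_iff.1 hz), inner_neg_left, inner_adj, hcancel, hconj]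
  · intro z hz u v
    rw [D.hess_apply (D.mem_interior_dualCone_iff.1 hz), real_inner_comm, inner_adj,
      Matrix.mul_assoc _ (T z)⁻¹, hcancel, hcancel]
    have h : C * ((D.LamSum z)⁻¹ * D.LamSum v) * C⁻¹ * (C * ((D.LamSum z)⁻¹ * D.LamSum u) * C⁻¹) =
        C * ((D.LamSum z)⁻¹ * D.LamSum v * (D.LamSum z)⁻¹ * D.LamSum u) * C⁻¹ := by
      simp only [Matrix.mul_assoc]
      rw [nonsing_inv_mul_cancel_left _ _ hu]
    rw [h, hconj]
  · intro v hv
    have h : Cᵀ * T v * C = D.LamSum v := by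
      rw [hT, transpose_nonsing_inv]
      simp only [Matrix.mul_assoc]
      rw [mul_nonsing_inv_cancel_left _ _ huT, nonsing_inv_mul _ hu, mul_one]
    rw [← h, hv, mul_zero, zero_mul]

variable {D}

namespace IsScaling

variable {x z u v : D.E} {T : D.E →ₗ[ℝ] Matrix (Σ i, Fin (D.L i)) (Σ i, Fin (D.L i)) ℝ}

theorem self_mem (h : D.IsScaling x T) : x ∈ interior D.dualCone := by
  rw [h.mem_interior, h.map_self]
  exact PosDef.one

theorem inner_hess_self (h : D.IsScaling x T) (u v : D.E) :
    inner ℝ u (D.hess x v) = (T v * T u).trace := by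
  rw [h.inner_hess x h.self_mem, h.map_self]
  simp

theorem localNorm_eq (h : D.IsScaling x T) (v : D.E) : D.localNorm x v = ‖T v‖ := by
  rw [localNorm, h.inner_hess_self, ← Real.sqrt_sq (norm_nonneg (T v)), frobenius_sq, h.symm]

theorem map_eq (h : D.IsScaling x T) (z : D.E) : T z = 1 + T (z - x) := by
  rw [map_sub, h.map_self, add_sub_cancel]

end IsScaling

variable {x z : D.E}

theorem inner_hess_comm (hx : x ∈ interior D.dualCone) (u v : D.E) :
    inner ℝ u (D.hess x v) = inner ℝ v (D.hess x u) := by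
  obtain ⟨T, h⟩ := D.exists_isScaling hx
  rw [h.inner_hess_self, h.inner_hess_self, trace_mul_comm]

theorem localNorm_nonneg (x v : D.E) : 0 ≤ D.localNorm x v := Real.sqrt_nonneg _

theorem localNorm_sq (hx : x ∈ interior D.dualCone) (v : D.E) :
    D.localNorm x v ^ 2 = inner ℝ v (D.hess x v) := by
  obtain ⟨T, h⟩ := D.exists_isScaling hx
  rw [h.localNorm_eq, h.inner_hess_self, frobenius_sq, h.symm]

theorem localNorm_add_le (hx : x ∈ interior D.dualCone) (u v : D.E) :
    D.localNorm x (u + v) ≤ D.localNorm x u + D.localNorm x v := by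
  obtain ⟨T, h⟩ := D.exists_isScaling hx
  rw [h.localNorm_eq, h.localNorm_eq, h.localNorm_eq, map_add]
  exact norm_add_le _ _

theorem localNorm_smul (x : D.E) (c : ℝ) (v : D.E) :
    D.localNorm x (c • v) = |c| * D.localNorm x v := by
  rw [localNorm, map_smul, inner_smul_left, inner_smul_right, conj_trivial, ← mul_assoc, ← pow_two,
    Real.sqrt_mul (sq_nonneg c), Real.sqrt_sq_eq_abs, localNorm]

theorem localNorm_neg (x v : D.E) : D.localNorm x (-v) = D.localNorm x v := by
  simpa using localNorm_smul x (-1) v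

theorem localNorm_sub_comm (x u v : D.E) : D.localNorm x (u - v) = D.localNorm x (v - u) := by
  rw [← localNorm_neg, neg_sub]

theorem localNorm_eq_zero {e : D.E} (he : e ∈ interior D.cone) (hx : x ∈ interior D.dualCone)
    {v : D.E} (hv : D.localNorm x v = 0) : v = 0 := by
  obtain ⟨T, h⟩ := D.exists_isScaling hx
  rw [h.localNorm_eq, norm_eq_zero] at hv
  exact D.eq_zero_of_lamSum_eq_zero he (h.eq_zero v hv)

theorem abs_inner_hess_le (hx : x ∈ interior D.dualCone) (u v : D.E) :
    |inner ℝ u (D.hess x v)| ≤ D.localNorm x u * D.localNorm x v := by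
  obtain ⟨T, h⟩ := D.exists_isScaling hx
  rw [h.localNorm_eq, h.localNorm_eq, h.inner_hess_self, mul_comm ‖T u‖]
  exact abs_trace_mul_le _ _

theorem hess_injective {e : D.E} (he : e ∈ interior D.cone) (hx : x ∈ interior D.dualCone) :
    Function.Injective (D.hess x) := by
  rw [injective_iff_map_eq_zero]
  intro v hv
  refine localNorm_eq_zero he hx ?_
  rw [localNorm, hv, inner_zero_right, Real.sqrt_zero]

theorem exists_hess_equiv {e : D.E} (he : e ∈ interior D.cone) (hx : x ∈ interior D.dualCone) :
    ∃ φ : D.E ≃L[ℝ] D.E, (φ : D.E →L[ℝ] D.E) = D.hess x ∧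
      (φ.symm : D.E →L[ℝ] D.E) = D.hessInv x := by
  let φ := (LinearEquiv.ofInjectiveEndo (D.hess x : D.E →ₗ[ℝ] D.E)
    (hess_injective he hx)).toContinuousLinearEquiv
  have h : (φ : D.E →L[ℝ] D.E) = D.hess x := by ext; rfl
  exact ⟨φ, h, by rw [hessInv, ← h, ContinuousLinearMap.inverse_equiv]⟩

theorem hess_hessInv {e : D.E} (he : e ∈ interior D.cone) (hx : x ∈ interior D.dualCone)
    (s : D.E) : D.hess x (D.hessInv x s) = s := by
  obtain ⟨φ, h, h'⟩ := exists_hess_equiv he hx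
  rw [← h, ← h']
  exact φ.apply_symm_apply s

theorem hessInv_hess {e : D.E} (he : e ∈ interior D.cone) (hx : x ∈ interior D.dualCone)
    (v : D.E) : D.hessInv x (D.hess x v) = v := by
  obtain ⟨φ, h, h'⟩ := exists_hess_equiv he hx
  rw [← h, ← h']
  exact φ.symm_apply_apply v

theorem dualNorm_eq {e : D.E} (he : e ∈ interior D.cone) (hx : x ∈ interior D.dualCone)
    (s : D.E) : D.dualNorm x s = D.localNorm x (D.hessInv x s) := by
  rw [dualNorm, localNorm, hess_hessInv he hx, real_inner_comm]

theorem hess_self (hx : x ∈ interior D.dualCone) : D.hess x x = -D.grad x := by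
  obtain ⟨T, h⟩ := D.exists_isScaling hx
  refine ext_inner_left ℝ fun u => ?_
  rw [h.inner_hess_self, inner_neg_right, real_inner_comm, h.inner_grad x hx, h.map_self]
  simp

theorem hessInv_grad {e : D.E} (he : e ∈ interior D.cone) (hx : x ∈ interior D.dualCone) :
    D.hessInv x (D.grad x) = -x := by
  rw [← neg_eq_iff_eq_neg, ← map_neg, ← hess_self hx, hessInv_hess he hx]

theorem inner_grad_self (hx : x ∈ interior D.dualCone) :
    inner ℝ (D.grad x) x = -(Fintype.card (Σ i, Fin (D.L i)) : ℝ) := by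
  obtain ⟨T, h⟩ := D.exists_isScaling hx
  rw [h.inner_grad x hx, h.map_self]
  simp

theorem mem_interior_of_localNorm_lt_one (hx : x ∈ interior D.dualCone)
    (hz : D.localNorm x (z - x) < 1) : z ∈ interior D.dualCone := by
  obtain ⟨T, h⟩ := D.exists_isScaling hx
  rw [h.localNorm_eq] at hz
  rw [h.mem_interior, h.map_eq]
  exact posDef_one_add (h.symm _) hz

theorem localNorm_le_div (hx : x ∈ interior D.dualCone) (hz : D.localNorm x (z - x) < 1)
    (u : D.E) : D.localNorm z u ≤ D.localNorm x u / (1 - D.localNorm x (z - x)) := by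
  have hzi := mem_interior_of_localNorm_lt_one hx hz
  obtain ⟨T, h⟩ := D.exists_isScaling hx
  have h1 : 0 ≤ D.localNorm x u / (1 - D.localNorm x (z - x)) :=
    div_nonneg (localNorm_nonneg _ _) (by linarith)
  refine le_of_sq_le_sq ?_ h1
  rw [localNorm_sq hzi, h.inner_hess z hzi, h.map_eq]
  rw [h.localNorm_eq, h.localNorm_eq] at *
  exact trace_inv_mul_inv_mul_le (h.symm _) hz _

theorem abs_inner_grad_sub_le (hx : x ∈ interior D.dualCone) (hz : D.localNorm x (z - x) < 1)
    (u : D.E) : |inner ℝ (D.grad z - D.grad x) u| ≤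
      D.localNorm x (z - x) / (1 - D.localNorm x (z - x)) * D.localNorm x u := by
  have hzi := mem_interior_of_localNorm_lt_one hx hz
  obtain ⟨T, h⟩ := D.exists_isScaling hx
  have h1 : inner ℝ (D.grad z - D.grad x) u = ((1 - (1 + T (z - x))⁻¹) * T u).trace := by
    rw [inner_sub_left, h.inner_grad z hzi, h.inner_grad x hx, h.map_eq z, h.map_self, sub_mul,
      trace_sub, inv_one]
    ring
  rw [h1]
  rw [h.localNorm_eq, h.localNorm_eq] at *
  exact (abs_trace_mul_le _ _).trans
    (mul_le_mul_of_nonneg_right (norm_one_sub_inv_le (h.symm _) hz) (norm_nonneg _))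

theorem abs_inner_grad_sub_hess_le (hx : x ∈ interior D.dualCone)
    (hz : D.localNorm x (z - x) < 1) (u : D.E) :
    |inner ℝ (D.grad z - D.grad x - D.hess x (z - x)) u| ≤
      D.localNorm x (z - x) ^ 2 / (1 - D.localNorm x (z - x)) * D.localNorm x u := by
  have hzi := mem_interior_of_localNorm_lt_one hx hz
  obtain ⟨T, h⟩ := D.exists_isScaling hx
  have h1 : inner ℝ (D.grad z - D.grad x - D.hess x (z - x)) u =
      ((1 - T (z - x) - (1 + T (z - x))⁻¹) * T u).trace := by
    rw [inner_sub_left, inner_sub_left, h.inner_grad z hzi, h.inner_grad x hx,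
      real_inner_comm, h.inner_hess_self, h.map_eq z, h.map_self, sub_mul, sub_mul, trace_sub,
      trace_sub, inv_one]
    ring
  rw [h1]
  rw [h.localNorm_eq, h.localNorm_eq] at *
  exact (abs_trace_mul_le _ _).trans
    (mul_le_mul_of_nonneg_right (norm_newton_remainder_le (h.symm _) hz) (norm_nonneg _))

/-- Monotonicity of g without any closeness assumption, needed to locate a gradient certificate
whose distance from x is not yet known. -/
theorem inner_grad_sub_ge (hx : x ∈ interior D.dualCone) (hz : z ∈ interior D.dualCone) :
    D.localNorm x (z - x) ^ 2 / (1 + D.localNorm x (z - x)) ≤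
      inner ℝ (D.grad z - D.grad x) (z - x) := by
  obtain ⟨T, h⟩ := D.exists_isScaling hx
  have hpd := (h.mem_interior z).1 hz
  rw [h.map_eq] at hpd
  have h1 := trace_sub_trace_inv_mul_ge (h.symm _) hpd
  rw [inner_sub_left, h.inner_grad z hz, h.inner_grad x hx, h.map_self, h.localNorm_eq, h.map_eq z,
    inv_one, one_mul]
  linarith

/-- In the scaled frame, T(z - x) ⪰ -‖T(z - x)‖ · 1 and T x = 1. -/
theorem sub_smul_mem_dualCone (hx : x ∈ interior D.dualCone) :
    z - (1 - D.localNorm x (z - x)) • x ∈ D.dualCone := by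
  obtain ⟨T, h⟩ := D.exists_isScaling hx
  rw [h.mem_dualCone]
  refine PosSemidef.of_dotProduct_mulVec_nonneg (by
    rw [IsHermitian, conjTranspose_eq_transpose_of_trivial, h.symm]) fun a => ?_
  have h1 := (abs_le.1 (abs_dotProduct_mulVec_le (T (z - x)) a)).1
  rw [h.localNorm_eq, star_trivial, map_sub T z, map_smul, h.map_eq z, h.map_self, sub_mulVec,
    add_mulVec, smul_mulVec, one_mulVec, dotProduct_sub, dotProduct_add, dotProduct_smul,
    smul_eq_mul]
  linarith

/-- H(x)v is `D.adj` of the congruence Λ(x)⁻¹ Λ(v) Λ(x)⁻¹, which preserves semidefiniteness. -/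
theorem hess_mem_cone (hx : x ∈ interior D.dualCone) {v : D.E} (hv : v ∈ D.dualCone) :
    D.hess x v ∈ D.cone := by
  have hpd := D.mem_interior_dualCone_iff.1 hx
  rw [D.hess_apply hpd]
  refine D.adj_mem_cone ?_
  have h := (D.mem_dualCone_iff.1 hv).mul_mul_conjTranspose_same (D.LamSum x)⁻¹
  rwa [hpd.inv.isHermitian.eq] at h

theorem hess_mem_interior_cone {e : D.E} (he : e ∈ interior D.cone)
    (hx : x ∈ interior D.dualCone) {v : D.E} (hv : v ∈ interior D.dualCone) :
    D.hess x v ∈ interior D.cone := by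
  obtain ⟨φ, h, -⟩ := exists_hess_equiv he hx
  have h1 : φ '' interior D.dualCone ⊆ interior D.cone := by
    refine interior_maximal ?_ (φ.toHomeomorph.isOpenMap _ isOpen_interior)
    rintro _ ⟨w, hw, rfl⟩
    have := hess_mem_cone hx (interior_subset hw)
    rwa [← h] at this
  rw [← h]
  exact h1 ⟨v, hv, rfl⟩

theorem neg_grad_mem_interior_cone {e : D.E} (he : e ∈ interior D.cone)
    (hx : x ∈ interior D.dualCone) : -D.grad x ∈ interior D.cone := by
  rw [← hess_self hx]
  exact hess_mem_interior_cone he hx hx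

theorem smul_mem_interior_dualCone (hx : x ∈ interior D.dualCone) {c : ℝ} (hc : 0 < c) :
    c • x ∈ interior D.dualCone := by
  rw [mem_interior_dualCone_iff] at *
  rw [← lamLin_apply, map_smul]
  exact hx.smul hc

theorem hess_smul (hx : x ∈ interior D.dualCone) {c : ℝ} (hc : 0 < c) (v : D.E) :
    D.hess (c • x) v = (c⁻¹ ^ 2) • D.hess x v := by
  have hpd := D.mem_interior_dualCone_iff.1 hx
  rw [D.hess_apply hpd,
    D.hess_apply (D.mem_interior_dualCone_iff.1 (smul_mem_interior_dualCone hx hc)),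
    ← lamLin_apply, map_smul, lamLin_apply, ← Units.smul_mk0 hc.ne',
    inv_smul' _ _ hpd.det_pos.ne'.isUnit, ← map_smul]
  congr 1
  rw [Units.smul_def]
  simp [smul_smul, pow_two]

theorem grad_smul (hx : x ∈ interior D.dualCone) {c : ℝ} (hc : 0 < c) :
    D.grad (c • x) = c⁻¹ • D.grad x := by
  have hcx := smul_mem_interior_dualCone hx hc
  have h := hess_smul hx hc (c • x)
  rw [hess_self hcx, map_smul, hess_self hx, smul_smul, smul_neg, neg_inj] at h
  rw [h]
  congr 1
  field_simp

end WSOS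

/-! ### Gradient certificates, the Newton step and rounding -/

namespace WSOS

open Matrix

variable {n m : ℕ} {D : WSOS n m} {x y s e : D.E}

theorem isClosed_dualCone : IsClosed D.dualCone := by
  have h : D.dualCone = ⋂ s ∈ D.cone, {y : D.E | 0 ≤ inner ℝ s y} := by
    ext y
    simp [dualCone]
  rw [h]
  exact isClosed_biInter fun s _ => isClosed_le continuous_const (by fun_prop)

theorem smul_mem_dualCone (hx : x ∈ D.dualCone) {c : ℝ} (hc : 0 ≤ c) : c • x ∈ D.dualCone := by
  intro s hs
  rw [inner_smul_right]
  exact mul_nonneg hc (hx s hs)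

theorem ne_zero_of_poly_eq_one (he : D.poly e = 1) : e ≠ 0 := by
  rintro rfl
  simp [poly] at he

theorem inner_pos_of_mem_interior (hx : x ∈ interior D.dualCone) (hs : s ∈ D.cone) (h0 : s ≠ 0) :
    0 < inner ℝ s x := by
  obtain ⟨ε, hε, h⟩ := D.exists_pos_mul_norm_le_inner_of_mem_interior hx
  exact (mul_pos hε (norm_pos_iff.2 h0)).trans_le (h s hs)

theorem nonempty_index (he : e ∈ interior D.cone) (h0 : e ≠ 0) :
    Nonempty (Σ i, Fin (D.L i)) := by
  by_contra h
  rw [not_nonempty_iff] at h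
  exact h0 (D.eq_zero_of_lamSum_eq_zero he (Subsingleton.elim _ _))

theorem det_lamSum_smul (c : ℝ) (x : D.E) :
    (D.LamSum (c • x)).det = c ^ Fintype.card (Σ i, Fin (D.L i)) * (D.LamSum x).det := by
  rw [← lamLin_apply, map_smul, det_smul, lamLin_apply]

theorem continuous_det_lamSum : Continuous fun x : D.E => (D.LamSum x).det :=
  D.continuous_lamSum.matrix_det

/-- The slice is compact because s is interior to Σ. It contains a point of positive determinant, so
the maximizer is not on the boundary of Σ*. -/
theorem exists_isMaxOn_det (hdual : (interior D.dualCone).Nonempty) (hs : s ∈ interior D.cone)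
    (hs0 : s ≠ 0) :
    ∃ y ∈ interior D.dualCone, inner ℝ s y = 1 ∧
      ∀ z ∈ D.dualCone, inner ℝ s z = 1 → (D.LamSum z).det ≤ (D.LamSum y).det := by
  obtain ⟨ε, hε, hle⟩ := exists_pos_mul_norm_le_inner hs
  obtain ⟨y₀, hy₀⟩ := hdual
  have hpos := inner_pos_of_mem_interior hy₀ (interior_subset hs) hs0
  set K : Set D.E := {z | z ∈ D.dualCone ∧ inner ℝ s z = 1} with hKdef
  have hK : IsCompact K := by
    refine Metric.isCompact_of_isClosed_isBounded
      (isClosed_dualCone.inter (isClosed_eq (by fun_prop) continuous_const))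
      (isBounded_iff_forall_norm_le.2 ⟨1 / ε, fun z hz => ?_⟩)
    rw [le_div_iff₀ hε, mul_comm, ← hz.2]
    exact hle z hz.1
  have hy₁ := smul_mem_interior_dualCone hy₀ (inv_pos.2 hpos)
  have hy₁K : (inner ℝ s y₀)⁻¹ • y₀ ∈ K :=
    ⟨interior_subset hy₁, by rw [inner_smul_right, inv_mul_cancel₀ hpos.ne']⟩
  obtain ⟨y, hy, hmax⟩ := hK.exists_isMaxOn ⟨_, hy₁K⟩ continuous_det_lamSum.continuousOn
  refine ⟨y, ?_, hy.2, fun z hz h1 => hmax ⟨hz, h1⟩⟩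
  rw [mem_interior_dualCone_iff, (D.mem_dualCone_iff.1 hy.1).posDef_iff_det_ne_zero]
  exact (((D.mem_interior_dualCone_iff.1 hy₁).det_pos).trans_le (hmax hy₁K)).ne'

/-- The function f(z) + ν ln⟨s, z⟩ is invariant under positive scaling, so the maximizer of det on
the slice minimizes it locally without constraint. Stationarity reads -g(y) = ν s, and ν y is the
certificate. -/
theorem exists_isGradCert (hdual : (interior D.dualCone).Nonempty) (he : e ∈ interior D.cone)
    (he0 : e ≠ 0) (hs : s ∈ interior D.cone) (hs0 : s ≠ 0) : ∃ y, D.IsGradCert y s := by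
  obtain ⟨y, hy, hy1, hmax⟩ := exists_isMaxOn_det hdual hs hs0
  have hne := nonempty_index he he0
  set ν : ℝ := (Fintype.card (Σ i, Fin (D.L i)) : ℝ) with hν
  have hν0 : 0 < ν := by
    rw [hν]
    exact_mod_cast Fintype.card_pos
  have hpd := D.mem_interior_dualCone_iff.1 hy
  have hdet {z : D.E} (hz : z ∈ interior D.dualCone) : 0 < (D.LamSum z).det :=
    (D.mem_interior_dualCone_iff.1 hz).det_pos
  have hloc : IsLocalMin (fun z : D.E => D.barrier z + ν * Real.log (inner ℝ s z)) y := by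
    filter_upwards [isOpen_interior.mem_nhds hy] with z hz
    have hp := inner_pos_of_mem_interior hz (interior_subset hs) hs0
    have h := hmax _ (smul_mem_dualCone (interior_subset hz) (inv_pos.2 hp).le)
      (by rw [inner_smul_right, inv_mul_cancel₀ hp.ne'])
    rw [det_lamSum_smul] at h
    have h1 := Real.log_le_log (mul_pos (pow_pos (inv_pos.2 hp) _) (hdet hz)) h
    rw [Real.log_mul (pow_pos (inv_pos.2 hp) _).ne' (hdet hz).ne', Real.log_pow, Real.log_inv]
      at h1
    simp only [barrier, hy1, Real.log_one]
    rw [← hν] at h1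
    linarith
  have hd1 := (D.hasGradientAt_barrier hpd).hasFDerivAt
  rw [← D.grad_eq hpd] at hd1
  have hd2 : HasFDerivAt (fun z : D.E => inner ℝ s z) (innerSL ℝ s) y := (innerSL ℝ s).hasFDerivAt
  have hd3 := hd1.add ((hd2.log (by rw [hy1]; exact one_ne_zero)).const_mul ν)
  have h0 := hloc.hasFDerivAt_eq_zero hd3
  have hg : D.grad y = -(ν • s) := by
    rw [eq_neg_iff_add_eq_zero]
    refine ext_inner_right ℝ fun u => ?_
    have h1 := DFunLike.congr_fun h0 u
    rw [hy1, inv_one, one_smul] at h1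
    rw [inner_add_left, inner_smul_left, inner_zero_left]
    exact h1
  refine ⟨ν • y, smul_mem_interior_dualCone hy hν0, ?_⟩
  rw [grad_smul hy hν0, hg, smul_neg, neg_neg, smul_smul, inv_mul_cancel₀ hν0.ne', one_smul]

theorem localNorm_le_of_abs_inner_hess_le (hx : x ∈ interior D.dualCone) {w : D.E} {k : ℝ}
    (hk : 0 ≤ k) (h : |inner ℝ (D.hess x w) w| ≤ k * D.localNorm x w) : D.localNorm x w ≤ k := by
  rw [real_inner_comm, ← localNorm_sq hx, abs_of_nonneg (sq_nonneg _), pow_two] at h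
  rcases (localNorm_nonneg x w).eq_or_lt with h0 | h0
  · rwa [← h0]
  · exact le_of_mul_le_mul_right h h0

theorem hess_residual (he : e ∈ interior D.cone) (hx : x ∈ interior D.dualCone) (s : D.E) :
    D.hess x (x - D.hessInv x s) = -D.grad x - s := by
  rw [map_sub, hess_self hx, hess_hessInv he hx]

theorem hessInv_mem_interior_dualCone (hx : x ∈ interior D.dualCone)
    (h : D.localNorm x (x - D.hessInv x s) < 1) : D.hessInv x s ∈ interior D.dualCone :=
  mem_interior_of_localNorm_lt_one hx (by rwa [localNorm_sub_comm])

theorem mem_interior_cone_of_residual_lt_one (he : e ∈ interior D.cone)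
    (hx : x ∈ interior D.dualCone) (h : D.localNorm x (x - D.hessInv x s) < 1) :
    s ∈ interior D.cone := by
  rw [← hess_hessInv he hx s]
  exact hess_mem_interior_cone he hx (hessInv_mem_interior_dualCone hx h)

theorem ne_zero_of_residual_lt_one (he : e ∈ interior D.cone) (he0 : e ≠ 0)
    (hx : x ∈ interior D.dualCone) (h : D.localNorm x (x - D.hessInv x s) < 1) : s ≠ 0 := by
  rintro rfl
  have h1 := hessInv_mem_interior_dualCone hx h
  rw [map_zero] at h1
  have h2 := inner_pos_of_mem_interior h1 (interior_subset he) he0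
  simp at h2

/-- A residual below 1 puts H(x)⁻¹ s in the interior of Σ*, hence s in that of Σ, so y exists.
Monotonicity then gives a²/(1 + a) ≤ a r/(r + 1) for a = ‖x - y‖_x, that is a ≤ r. -/
theorem exists_isGradCert_of_residual_le (he : e ∈ interior D.cone) (he0 : e ≠ 0)
    (hx : x ∈ interior D.dualCone) {r : ℝ} (hr : 0 < r)
    (h : D.localNorm x (x - D.hessInv x s) ≤ r / (r + 1)) :
    ∃ y, D.IsGradCert y s ∧ D.localNorm x (x - y) ≤ r := by
  have hr1 : r / (r + 1) < 1 := by rw [div_lt_one (by linarith)]; linarith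
  have h1 := h.trans_lt hr1
  obtain ⟨y, hy⟩ := exists_isGradCert ⟨x, hx⟩ he he0
    (mem_interior_cone_of_residual_lt_one he hx h1) (ne_zero_of_residual_lt_one he he0 hx h1)
  refine ⟨y, hy, ?_⟩
  rw [localNorm_sub_comm]
  have h2 := inner_grad_sub_ge hx hy.1
  have h3 : D.grad y - D.grad x = D.hess x (x - D.hessInv x s) := by
    rw [hess_residual he hx, ← hy.2]; abel
  rw [h3] at h2
  have h4 := (le_abs_self _).trans (abs_inner_hess_le hx (y - x) (x - D.hessInv x s))
  rw [real_inner_comm] at h2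
  have ha := localNorm_nonneg x (y - x)
  set a := D.localNorm x (y - x)
  have h5 : a ^ 2 / (1 + a) ≤ a * (r / (r + 1)) :=
    (h2.trans h4).trans (mul_le_mul_of_nonneg_left h ha)
  rcases ha.eq_or_lt with h0 | h0
  · rw [← h0]; exact hr.le
  · rw [← mul_div_assoc, div_le_div_iff₀ (by linarith) (by linarith)] at h5
    nlinarith

theorem residual_le (he : e ∈ interior D.cone) (hx : x ∈ interior D.dualCone)
    (hy : D.IsGradCert y s) (h : D.localNorm x (x - y) < 1) :
    D.localNorm x (x - D.hessInv x s) ≤ D.localNorm x (x - y) / (1 - D.localNorm x (x - y)) := by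
  refine localNorm_le_of_abs_inner_hess_le hx
    (div_nonneg (localNorm_nonneg _ _) (by linarith)) ?_
  rw [hess_residual he hx, ← hy.2, show -D.grad x - -D.grad y = D.grad y - D.grad x by abel]
  rw [localNorm_sub_comm x x y] at *
  exact abs_inner_grad_sub_le hx h _

theorem newton_le (he : e ∈ interior D.cone) (hx : x ∈ interior D.dualCone)
    (hy : D.IsGradCert y s) (h : D.localNorm x (x - y) < 1) :
    D.localNorm x ((2 : ℝ) • x - D.hessInv x s - y) ≤
      D.localNorm x (x - y) ^ 2 / (1 - D.localNorm x (x - y)) := by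
  refine localNorm_le_of_abs_inner_hess_le hx (div_nonneg (sq_nonneg _) (by linarith)) ?_
  have h1 : D.hess x ((2 : ℝ) • x - D.hessInv x s - y) =
      D.grad y - D.grad x - D.hess x (y - x) := by
    rw [map_sub, map_sub, map_smul, map_sub, hess_hessInv he hx, hess_self hx, ← hy.2, two_smul]
    abel
  rw [h1]
  rw [localNorm_sub_comm x x y] at *
  exact abs_inner_grad_sub_hess_le hx h _

/-- As x₊ - x is the residual vector, its length is at most a/(1 - a) < 1. Changing the norm from x
to x₊ costs the factor 1/(1 - a/(1 - a)), which turns the Newton error a²/(1 - a) into a²/(1 - 2a).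
-/
theorem newton_mem_and_le (he : e ∈ interior D.cone) (hx : x ∈ interior D.dualCone)
    (hy : D.IsGradCert y s) {r : ℝ} (hr4 : r ≤ 1 / 4) (h : D.localNorm x (x - y) ≤ r) :
    (2 : ℝ) • x - D.hessInv x s ∈ interior D.dualCone ∧
      D.localNorm ((2 : ℝ) • x - D.hessInv x s) ((2 : ℝ) • x - D.hessInv x s - y) ≤
        r ^ 2 / (1 - 2 * r) := by
  have h1 : D.localNorm x (x - y) < 1 := by linarith
  have h2 := residual_le he hx hy h1
  have h3 := newton_le he hx hy h1
  have ha := localNorm_nonneg x (x - y)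
  set a := D.localNorm x (x - y)
  have h4 : a / (1 - a) < 1 := by rw [div_lt_one (by linarith)]; linarith
  have h5 : (2 : ℝ) • x - D.hessInv x s - x = x - D.hessInv x s := by rw [two_smul]; abel
  have h6 : D.localNorm x ((2 : ℝ) • x - D.hessInv x s - x) ≤ a / (1 - a) := by rwa [h5]
  refine ⟨mem_interior_of_localNorm_lt_one hx (h6.trans_lt h4), ?_⟩
  refine (localNorm_le_div hx (h6.trans_lt h4) _).trans ?_
  have h7 : 1 - a / (1 - a) = (1 - 2 * a) / (1 - a) := by
    have : (1 - a) ≠ 0 := by linarith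
    field_simp
    ring
  calc _ ≤ a ^ 2 / (1 - a) / (1 - a / (1 - a)) := by gcongr
    _ = a ^ 2 / (1 - 2 * a) := by
      rw [h7, div_div_div_cancel_right₀ (by linarith)]
    _ ≤ r ^ 2 / (1 - 2 * r) := by
      gcongr
      linarith

theorem localNorm_le_sqrt_norm_hess (x v : D.E) : D.localNorm x v ≤ √‖D.hess x‖ * ‖v‖ := by
  rw [localNorm]
  refine Real.sqrt_le_iff.2 ⟨by positivity, ?_⟩
  rw [mul_pow, Real.sq_sqrt (norm_nonneg _)]
  calc inner ℝ v (D.hess x v) ≤ ‖v‖ * ‖D.hess x v‖ := real_inner_le_norm _ _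
    _ ≤ ‖v‖ * (‖D.hess x‖ * ‖v‖) := by gcongr; exact (D.hess x).le_opNorm v
    _ = _ := by ring

theorem exists_isRounding (D : WSOS n m) {N : ℕ} (hN : 0 < N) (xp : D.E) :
    ∃ xN, D.IsRounding N xp xN := by
  have hN' : (0 : ℝ) < N := by exact_mod_cast hN
  refine ⟨WithLp.toLp 2 fun u => (round ((N : ℝ) * xp u) : ℝ) / N, fun u => ⟨?_, _, rfl⟩⟩
  have h := abs_sub_round ((N : ℝ) * xp u)
  have h1 : ((round ((N : ℝ) * xp u) : ℝ) / N) - xp u =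
      -(((N : ℝ) * xp u - round ((N : ℝ) * xp u)) / N) := by
    field_simp
    ring
  change |((round ((N : ℝ) * xp u) : ℝ) / N) - xp u| ≤ _
  rw [h1, abs_neg, abs_div, abs_of_pos hN', ← div_div]
  gcongr

theorem IsRounding.norm_sub_le {N : ℕ} {xp xN : D.E} (h : D.IsRounding N xp xN) :
    ‖xN - xp‖ ≤ √(D.U : ℝ) * (1 / (2 * (N : ℝ))) := by
  rw [EuclideanSpace.norm_eq]
  refine Real.sqrt_le_iff.2 ⟨by positivity, ?_⟩
  rw [mul_pow, Real.sq_sqrt (Nat.cast_nonneg _)]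
  calc ∑ u, ‖(xN - xp) u‖ ^ 2 ≤ ∑ _u : Fin D.U, (1 / (2 * (N : ℝ))) ^ 2 := by
        refine Finset.sum_le_sum fun u _ => ?_
        gcongr
        exact (h u).1
    _ = _ := by simp

theorem IsRounding.isRatVec {N : ℕ} {xp xN : D.E} (h : D.IsRounding N xp xN) :
    D.IsRatVec xN := fun u => by
  obtain ⟨k, hk⟩ := (h u).2
  exact ⟨(k : ℚ) / (N : ℚ), by rw [hk]; push_cast; rfl⟩

theorem denominator_pos (he : e ∈ interior D.cone) (he0 : e ≠ 0) {xp : D.E}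
    (hxp : xp ∈ interior D.dualCone) {r rN : ℝ} (h1 : r ^ 2 / (1 - 2 * r) < rN) (hrN : 0 < rN) :
    0 < D.denominator r rN xp := by
  have hU : 0 < D.U := by
    obtain ⟨u, -⟩ : ∃ u, e u ≠ 0 := by
      by_contra! h
      exact he0 (by ext u; simpa using h u)
    exact u.pos
  have hH : 0 < ‖D.hess xp‖ := by
    rw [norm_pos_iff]
    intro h0
    exact he0 (hess_injective he hxp (by simp [h0]))
  have hU' : (0 : ℝ) < D.U := by exact_mod_cast hU
  have h2 : 0 < rN - r ^ 2 / (1 - 2 * r) := by linarith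
  rw [denominator, Nat.ceil_pos]
  positivity

theorem IsRounding.mem_and_le {xp xN : D.E} (hxp : xp ∈ interior D.dualCone) {ε rN : ℝ}
    (hε0 : 0 ≤ ε) (hε : ε < rN) (hle : D.localNorm xp (xp - y) ≤ ε) {N : ℕ} (hN0 : 0 < N)
    (hN : √(D.U : ℝ) / 2 * ((1 + rN) / (rN - ε)) * √‖D.hess xp‖ ≤ N)
    (h : D.IsRounding N xp xN) :
    xN ∈ interior D.dualCone ∧ D.localNorm xN (xN - y) ≤ rN := by
  have hN' : (0 : ℝ) < N := by exact_mod_cast hN0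
  have hd : 0 < rN - ε := by linarith
  -- The displacement allowance η = (rN - ε)/(1 + rN) solves (η + ε)/(1 - η) = rN, where 1/(1 - η)
  -- is the cost of changing the norm to xN.
  have hη : D.localNorm xp (xN - xp) ≤ (rN - ε) / (1 + rN) := by
    refine (localNorm_le_sqrt_norm_hess _ _).trans
      ((mul_le_mul_of_nonneg_left h.norm_sub_le (Real.sqrt_nonneg _)).trans ?_)
    rw [le_div_iff₀ (by linarith)]
    rw [← mul_div_assoc, div_mul_eq_mul_div, div_le_iff₀ hd] at hN
    have h1 : √‖D.hess xp‖ * (√(D.U : ℝ) * (1 / (2 * (N : ℝ)))) * (1 + rN) =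
        (√(D.U : ℝ) / 2 * (1 + rN) * √‖D.hess xp‖) / N := by
      field_simp
    rw [h1, div_le_iff₀ hN']
    linarith
  have hη1 : (rN - ε) / (1 + rN) < 1 := by rw [div_lt_one (by linarith)]; linarith
  refine ⟨mem_interior_of_localNorm_lt_one hxp (hη.trans_lt hη1), ?_⟩
  have h1 := localNorm_le_div hxp (hη.trans_lt hη1) (xN - y)
  have h2 : D.localNorm xp (xN - y) ≤ (rN - ε) / (1 + rN) + ε := by
    have h3 := localNorm_add_le hxp (xN - xp) (xp - y)
    rw [sub_add_sub_cancel] at h3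
    linarith
  refine h1.trans ?_
  rw [div_le_iff₀ (by linarith)]
  have h4 : (rN - ε) / (1 + rN) + ε = rN * (1 - (rN - ε) / (1 + rN)) := by
    have : 1 + rN ≠ 0 := by linarith
    field_simp
    ring
  have hrN : 0 ≤ rN := by linarith
  nlinarith

end WSOS

/-! ### Rational matrices -/

section RationalMatrix

open Matrix

variable {ι : Type*}

/-- All entries of the matrix are rational. -/
def IsRatMat (M : Matrix ι ι ℝ) : Prop := ∃ K : Matrix ι ι ℚ, M = K.map (Rat.castHom ℝ)

theorem isRatMat_of_forall {M : Matrix ι ι ℝ} (h : ∀ i j, ∃ a : ℚ, M i j = (a : ℝ)) :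
    IsRatMat M := by
  choose K hK using h
  exact ⟨Matrix.of K, by ext i j; simp [hK]⟩

theorem IsRatMat.mul [Fintype ι] {M K : Matrix ι ι ℝ} (hM : IsRatMat M) (hK : IsRatMat K) :
    IsRatMat (M * K) := by
  obtain ⟨M, rfl⟩ := hM
  obtain ⟨K, rfl⟩ := hK
  exact ⟨M * K, by rw [Matrix.map_mul]⟩

theorem IsRatMat.trace [Fintype ι] {M : Matrix ι ι ℝ} (hM : IsRatMat M) :
    ∃ a : ℚ, M.trace = (a : ℝ) := by
  obtain ⟨M, rfl⟩ := hM
  exact ⟨M.trace, by simp [Matrix.trace]⟩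

theorem IsRatMat.inv [Fintype ι] [DecidableEq ι] {M : Matrix ι ι ℝ} (hM : IsRatMat M)
    (hu : IsUnit M.det) : IsRatMat M⁻¹ := by
  obtain ⟨K, rfl⟩ := hM
  refine ⟨K⁻¹, inv_eq_right_inv ?_⟩
  have hK : IsUnit K.det := by
    rw [← RingHom.mapMatrix_apply, ← RingHom.map_det] at hu
    exact isUnit_iff_ne_zero.2 fun h => hu.ne_zero (by rw [h, map_zero])
  rw [← Matrix.map_mul, mul_nonsing_inv _ hK]
  simp

theorem IsRatMat.mulVec [Fintype ι] {M : Matrix ι ι ℝ} (hM : IsRatMat M) {v : ι → ℝ}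
    (hv : ∀ i, ∃ a : ℚ, v i = (a : ℝ)) (i : ι) : ∃ a : ℚ, (M *ᵥ v) i = (a : ℝ) := by
  obtain ⟨K, rfl⟩ := hM
  choose w hw using hv
  exact ⟨(K *ᵥ w) i, by simp [Matrix.mulVec, dotProduct, hw]⟩

end RationalMatrix

/-! ### Rationality of the iterates and the quadratic for the bound -/

namespace WSOS

open Matrix

variable {n m : ℕ} {D : WSOS n m} {x y s e v t : D.E}

theorem IsRatVec.add (hx : D.IsRatVec x) (hy : D.IsRatVec y) : D.IsRatVec (x + y) := fun u => by
  obtain ⟨a, ha⟩ := hx u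
  obtain ⟨b, hb⟩ := hy u
  exact ⟨a + b, by simp [ha, hb]⟩

theorem IsRatVec.smul (hx : D.IsRatVec x) (c : ℚ) : D.IsRatVec ((c : ℝ) • x) := fun u => by
  obtain ⟨a, ha⟩ := hx u
  exact ⟨c * a, by simp [ha]⟩

theorem IsRatVec.sub (hx : D.IsRatVec x) (hy : D.IsRatVec y) : D.IsRatVec (x - y) := by
  have h := hx.add (hy.smul (-1))
  simpa [sub_eq_add_neg] using h

theorem IsRatVec.inner (hx : D.IsRatVec x) (hy : D.IsRatVec y) :
    ∃ a : ℚ, inner ℝ x y = (a : ℝ) := by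
  choose a ha using hx
  choose b hb using hy
  exact ⟨∑ u, b u * a u, by simp [PiLp.inner_apply, ha, hb]⟩

theorem isRatVec_single (D : WSOS n m) (u : Fin D.U) :
    D.IsRatVec (EuclideanSpace.single u 1) := fun v => by
  refine ⟨if v = u then 1 else 0, ?_⟩
  by_cases h : v = u <;> simp [h]

theorem IsRatLam.lamSum (hL : D.IsRatLam) (hx : D.IsRatVec x) : IsRatMat (D.LamSum x) := by
  refine isRatMat_of_forall fun ⟨i, j⟩ ⟨i', k⟩ => ?_
  rcases eq_or_ne i i' with rfl | h
  · simpa [LamSum] using hL x hx i j k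
  · exact ⟨0, by simp [LamSum, blockDiagonal'_apply_ne _ _ _ h]⟩

theorem IsRatLam.adj (hL : D.IsRatLam) {S : Matrix (Σ i, Fin (D.L i)) (Σ i, Fin (D.L i)) ℝ}
    (hS : IsRatMat S) : D.IsRatVec (D.adj S) := fun u =>
  (hS.mul (hL.lamSum (D.isRatVec_single u))).trace

theorem IsRatLam.hess (hL : D.IsRatLam) (hx : x ∈ interior D.dualCone) (hxr : D.IsRatVec x)
    (hv : D.IsRatVec v) : D.IsRatVec (D.hess x v) := by
  have hpd := D.mem_interior_dualCone_iff.1 hx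
  rw [D.hess_apply hpd]
  have hi := (hL.lamSum hxr).inv hpd.det_pos.ne'.isUnit
  exact hL.adj ((hi.mul (hL.lamSum hv)).mul hi)

theorem IsRatLam.hessInv (hL : D.IsRatLam) (he : e ∈ interior D.cone)
    (hx : x ∈ interior D.dualCone) (hxr : D.IsRatVec x) (hs : D.IsRatVec s) :
    D.IsRatVec (D.hessInv x s) := by
  -- K is the matrix of H(x) in the standard basis; rationality of its inverse carries over to
  -- H(x)⁻¹.
  let K : Matrix (Fin D.U) (Fin D.U) ℝ :=
    Matrix.of fun u v => D.hess x (EuclideanSpace.single v 1) u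
  have hK : IsRatMat K := isRatMat_of_forall fun u v => hL.hess hx hxr (D.isRatVec_single v) u
  have hKv (z : D.E) : K *ᵥ z.ofLp = (D.hess x z).ofLp := by
    have h : z = ∑ u, z u • (EuclideanSpace.single u 1 : D.E) := by
      ext v
      simp [Pi.single_apply]
    conv_rhs => rw [h, map_sum]
    ext u
    simp [K, Matrix.mulVec, dotProduct, mul_comm]
  have hu : IsUnit K.det := by
    rw [← isUnit_iff_isUnit_det, ← mulVec_injective_iff_isUnit]
    intro a b hab
    have h1 := hKv (WithLp.toLp 2 a)
    have h2 := hKv (WithLp.toLp 2 b)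
    have h3 : D.hess x (WithLp.toLp 2 a) = D.hess x (WithLp.toLp 2 b) := by
      ext u
      exact congrFun (h1.symm.trans (hab.trans h2)) u
    exact congrArg WithLp.ofLp (hess_injective he hx h3)
  have h4 : (D.hessInv x s).ofLp = K⁻¹ *ᵥ s.ofLp := by
    have h5 := hKv (D.hessInv x s)
    rw [hess_hessInv he hx] at h5
    rw [← h5, mulVec_mulVec, nonsing_inv_mul _ hu, one_mulVec]
  intro u
  rw [h4]
  exact (hK.inv hu).mulVec hs u

theorem localNorm_sub_hessInv_sq (he : e ∈ interior D.cone) (hx : x ∈ interior D.dualCone)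
    (s : ℝ) : D.localNorm x (x - D.hessInv x (t - s • e)) ^ 2 =
      inner ℝ e (D.hessInv x e) * s ^ 2 + 2 * inner ℝ (x - D.hessInv x t) e * s +
        inner ℝ (x - D.hessInv x t) (D.hess x (x - D.hessInv x t)) := by
  have h : x - D.hessInv x (t - s • e) = (x - D.hessInv x t) + s • D.hessInv x e := by
    rw [map_sub, map_smul]; abel
  rw [localNorm_sq hx, h]
  set p := x - D.hessInv x t
  have h1 : inner ℝ (D.hessInv x e) (D.hess x p) = inner ℝ p e := by
    rw [inner_hess_comm hx, hess_hessInv he hx]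
  rw [map_add, map_smul, hess_hessInv he hx]
  simp only [inner_add_left, inner_add_right, inner_smul_left, inner_smul_right, conj_trivial, h1]
  rw [real_inner_comm e (D.hessInv x e)]
  ring

theorem solvesUpdate_iff (he : e ∈ interior D.cone) (hx : x ∈ interior D.dualCone) {r : ℝ}
    (hr : 0 ≤ r) (s : ℝ) : D.SolvesUpdate e t r x s ↔
      inner ℝ e (D.hessInv x e) * s ^ 2 + 2 * inner ℝ (x - D.hessInv x t) e * s +
        (inner ℝ (x - D.hessInv x t) (D.hess x (x - D.hessInv x t)) - (r / (r + 1)) ^ 2) = 0 := by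
  rw [SolvesUpdate, ← sq_eq_sq₀ (localNorm_nonneg _ _) (by positivity),
    localNorm_sub_hessInv_sq he hx, ← add_sub_assoc, sub_eq_zero]

theorem inner_hessInv_pos (he : e ∈ interior D.cone) (he0 : e ≠ 0)
    (hx : x ∈ interior D.dualCone) : 0 < inner ℝ e (D.hessInv x e) := by
  have h1 := localNorm_sq hx (D.hessInv x e)
  rw [hess_hessInv he hx, real_inner_comm] at h1
  rw [← h1]
  refine sq_pos_of_ne_zero fun h => he0 ?_
  rw [← hess_hessInv he hx e, localNorm_eq_zero he hx h, map_zero]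

end WSOS

theorem exists_isGreatest_quadratic {α β γ c : ℝ} (hα : 0 < α) (hc : α * c ^ 2 + β * c + γ < 0) :
    ∃ s, IsGreatest {s : ℝ | α * s ^ 2 + β * s + γ = 0} s ∧ c < s := by
  -- A negative value at c places c strictly between the two roots.
  have hd : (2 * α * c + β) ^ 2 < discrim α β γ := by
    rw [discrim]
    nlinarith
  have hd0 : 0 ≤ discrim α β γ := (sq_nonneg _).trans hd.le
  have hroot (s : ℝ) : α * s ^ 2 + β * s + γ = 0 ↔
      s = (-β + √(discrim α β γ)) / (2 * α) ∨ s = (-β - √(discrim α β γ)) / (2 * α) := by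
    rw [pow_two]
    exact quadratic_eq_zero_iff hα.ne' (Real.mul_self_sqrt hd0).symm s
  have h1 := Real.lt_sqrt_of_sq_lt hd
  refine ⟨(-β + √(discrim α β γ)) / (2 * α), ⟨(hroot _).2 (Or.inl rfl), fun s hs => ?_⟩, ?_⟩
  · rcases (hroot s).1 hs with rfl | rfl
    · rfl
    · have := Real.sqrt_nonneg (discrim α β γ)
      gcongr
      linarith
  · rw [lt_div_iff₀ (by linarith)]
    linarith

/-! ### The optimal bound, the residual and the initial state -/

namespace WSOS

variable {n m : ℕ} {D : WSOS n m} {x y e t : D.E}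

theorem exists_isGreatest_bound (hdual : (interior D.dualCone).Nonempty)
    (he : e ∈ interior D.cone) (he0 : e ≠ 0) (t : D.E) :
    ∃ cstar : ℝ, IsGreatest {c : ℝ | t - c • e ∈ D.cone} cstar := by
  have hcl : IsClosed {c : ℝ | t - c • e ∈ D.cone} :=
    (D.isClosed_cone hdual).preimage (by fun_prop)
  obtain ⟨y, hy⟩ := hdual
  have hey := inner_pos_of_mem_interior hy (interior_subset he) he0
  have hbdd : BddAbove {c : ℝ | t - c • e ∈ D.cone} := by
    refine ⟨inner ℝ t y / inner ℝ e y, fun c hc => ?_⟩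
    have h := (interior_subset hy : y ∈ D.dualCone) _ hc
    rw [inner_sub_left, inner_smul_left, conj_trivial] at h
    rw [le_div_iff₀ hey]
    linarith
  -- For small a > 0 the vector e + a t stays in Σ; dividing by a shows that -1/a is feasible.
  have hne : {c : ℝ | t - c • e ∈ D.cone}.Nonempty := by
    have hlim : Tendsto (fun a : ℝ => e + a • t) (𝓝 0) (𝓝 e) := by
      have h : Continuous fun a : ℝ => e + a • t := by fun_prop
      simpa using h.tendsto 0
    have h1 := hlim.eventually (isOpen_interior.mem_nhds he)
    obtain ⟨a, ha, ha0⟩ := ((h1.filter_mono nhdsWithin_le_nhds).and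
      (self_mem_nhdsWithin : Set.Ioi (0 : ℝ) ∈ 𝓝[>] 0)).exists
    have ha0' : (0 : ℝ) < a := ha0
    refine ⟨-a⁻¹, ?_⟩
    have h2 := D.smul_mem_cone (interior_subset ha) (inv_pos.2 ha0').le
    rw [smul_add, smul_smul, inv_mul_cancel₀ ha0'.ne', one_smul] at h2
    change t - (-a⁻¹) • e ∈ D.cone
    rwa [neg_smul, sub_neg_eq_add, add_comm]
  exact ⟨_, hcl.csSup_mem hne hbdd, fun c hc => le_csSup hbdd hc⟩

theorem IsGradCert.mem_interior_cone (he : e ∈ interior D.cone) {s : D.E}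
    (hy : D.IsGradCert y s) : s ∈ interior D.cone := by
  rw [← hy.2]
  exact neg_grad_mem_interior_cone he hy.1

theorem IsGradCert.lt_bound (he : e ∈ interior D.cone) {c cstar : ℝ}
    (hy : D.IsGradCert y (t - c • e)) (hc : IsGreatest {c : ℝ | t - c • e ∈ D.cone} cstar) :
    c < cstar := by
  have hlim : Tendsto (fun a : ℝ => t - a • e) (𝓝 c) (𝓝 (t - c • e)) := by
    have h : Continuous fun a : ℝ => t - a • e := by fun_prop
    exact h.tendsto c
  have h1 := hlim.eventually (isOpen_interior.mem_nhds (hy.mem_interior_cone he))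
  obtain ⟨a, ha, ha0⟩ := ((h1.filter_mono nhdsWithin_le_nhds).and
    (self_mem_nhdsWithin : Set.Ioi c ∈ 𝓝[>] c)).exists
  have ha' : t - a • e ∈ interior D.cone := ha
  exact lt_of_lt_of_le (Set.mem_Ioi.1 ha0) (hc.2 (show t - a • e ∈ D.cone from interior_subset ha'))

/-- With d = ‖e‖*_x, the vector d x - H(x)⁻¹ e lies in Σ*; pairing it with e gives d ⟨e, x⟩ ≥ d². -/
theorem dualNorm_le_inner (he : e ∈ interior D.cone) (hx : x ∈ interior D.dualCone) :
    D.dualNorm x e ≤ inner ℝ e x := by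
  rw [dualNorm_eq he hx]
  have h := sub_smul_mem_dualCone (z := x - D.hessInv x e) hx _ (interior_subset he)
  have hsq := localNorm_sq hx (D.hessInv x e)
  rw [hess_hessInv he hx, real_inner_comm] at hsq
  rw [sub_sub_cancel_left, localNorm_neg, inner_sub_right, inner_sub_right, inner_smul_right,
    ← hsq] at h
  rcases (localNorm_nonneg x (D.hessInv x e)).eq_or_lt with h0 | h0
  · rw [← h0]
    exact (interior_subset hx : x ∈ D.dualCone) _ (interior_subset he)
  · refine le_of_mul_le_mul_left ?_ h0
    linarith

/-- Pairing t - c*e ∈ Σ with y gives (c* - c)⟨e, y⟩ ≤ ⟨-g(y), y⟩ = ν. Closeness puts y - x/2 in Σ*,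
so ⟨e, y⟩ ≥ ⟨e, x⟩/2 ≥ ‖e‖*_x/2. -/
theorem gap_mul_dualNorm_le (he : e ∈ interior D.cone) (hx : x ∈ interior D.dualCone)
    {c cstar : ℝ} (hy : D.IsGradCert y (t - c • e)) (hxy : D.localNorm x (x - y) ≤ 1 / 2)
    (hcc : c ≤ cstar) (hcstar : t - cstar • e ∈ D.cone) :
    (cstar - c) * D.dualNorm x e ≤ 2 * Fintype.card (Σ i, Fin (D.L i)) := by
  have h1 := dualNorm_le_inner he hx
  have h2 := sub_smul_mem_dualCone (z := y) hx _ (interior_subset he)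
  rw [localNorm_sub_comm, inner_sub_right, inner_smul_right] at h2
  have h3 := (interior_subset hy.1 : y ∈ D.dualCone) _ hcstar
  have h4 : t - cstar • e = -D.grad y - (cstar - c) • e := by
    rw [hy.2, sub_smul]; abel
  rw [h4, inner_sub_left, inner_neg_left, inner_grad_self hy.1, inner_smul_left, conj_trivial] at h3
  have h5 : 0 ≤ inner ℝ e x := (Real.sqrt_nonneg _).trans h1
  have h6 : 1 / 2 * inner ℝ e x ≤ inner ℝ e y := by nlinarith
  nlinarith

/-- The left-hand side `‖x - H(x)⁻¹ (t - c 1)‖_x` of the equation for the new bound. -/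
noncomputable def residual (e t x : D.E) (c : ℝ) : ℝ :=
  D.localNorm x (x - D.hessInv x (t - c • e))

theorem residual_convex (hx : x ∈ interior D.dualCone) {c₁ c₂ c R : ℝ}
    (h₁ : D.residual e t x c₁ ≤ R) (h₂ : D.residual e t x c₂ ≤ R) (hc : c ∈ Set.Icc c₁ c₂) :
    D.residual e t x c ≤ R := by
  rcases hc.1.eq_or_lt with rfl | hlt
  · exact h₁
  have h0 : 0 < c₂ - c₁ := by linarith [hc.2]
  set θ := (c - c₁) / (c₂ - c₁) with hθ
  have hθ0 : 0 ≤ θ := div_nonneg (by linarith) h0.le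
  have hθ1 : θ ≤ 1 := by rw [hθ, div_le_one h0]; linarith [hc.2]
  have hcθ : c = (1 - θ) * c₁ + θ * c₂ := by
    rw [hθ]
    field_simp
    ring
  have h : x - D.hessInv x (t - c • e) = (1 - θ) • (x - D.hessInv x (t - c₁ • e)) +
      θ • (x - D.hessInv x (t - c₂ • e)) := by
    rw [hcθ]
    simp only [map_sub, map_smul]
    module
  rw [residual, h]
  refine (localNorm_add_le hx _ _).trans ?_
  rw [localNorm_smul, localNorm_smul, abs_of_nonneg hθ0, abs_of_nonneg (by linarith)]
  change (1 - θ) * D.residual e t x c₁ + θ * D.residual e t x c₂ ≤ R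
  nlinarith

theorem residual_le_add (he : e ∈ interior D.cone) (hx : x ∈ interior D.dualCone) {c₁ c₂ : ℝ}
    (h : c₁ ≤ c₂) :
    D.residual e t x c₂ ≤ D.residual e t x c₁ + (c₂ - c₁) * D.dualNorm x e := by
  have h1 : x - D.hessInv x (t - c₂ • e) = (x - D.hessInv x (t - c₁ • e)) +
      (c₂ - c₁) • D.hessInv x e := by
    simp only [map_sub, map_smul]
    module
  rw [residual, h1]
  refine (localNorm_add_le hx _ _).trans ?_
  rw [localNorm_smul, abs_of_nonneg (by linarith), dualNorm_eq he hx, residual]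

theorem exists_isBoundUpdate (he : e ∈ interior D.cone) (he0 : e ≠ 0)
    (hx : x ∈ interior D.dualCone) {r c : ℝ} (hr : 0 ≤ r)
    (h : D.residual e t x c < r / (r + 1)) :
    ∃ cp, D.IsBoundUpdate e t r x cp ∧ c < cp := by
  have hset : {s | D.SolvesUpdate e t r x s} = _ :=
    Set.ext fun s => solvesUpdate_iff (t := t) he hx hr s
  have hsq : D.residual e t x c ^ 2 < (r / (r + 1)) ^ 2 :=
    pow_lt_pow_left₀ h (localNorm_nonneg _ _) two_ne_zero
  rw [residual, localNorm_sub_hessInv_sq he hx] at hsq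
  simp only [IsBoundUpdate, hset]
  exact exists_isGreatest_quadratic (inner_hessInv_pos he he0 hx) (by linarith)

theorem exists_isBoundRounding {c cp : ℝ} (h : c < cp) : ∃ a : ℚ, IsBoundRounding c cp a := by
  classical
  obtain ⟨q, hq1, hq2⟩ := exists_rat_btwn (show c + (cp - c) / 2 < cp by linarith)
  have hex : ∃ k : ℕ, ∃ a : ℚ, (a : ℝ) ∈ Set.Icc (c + (cp - c) / 2) cp ∧ a.den = k :=
    ⟨_, q, ⟨hq1.le, hq2.le⟩, rfl⟩
  obtain ⟨a, ha, hak⟩ := Nat.find_spec hex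
  exact ⟨a, ha, fun b hb => hak ▸ Nat.find_min' hex ⟨b, hb, rfl⟩⟩

theorem invariant_of_residual_le (he : e ∈ interior D.cone) (he0 : e ≠ 0)
    (hx : x ∈ interior D.dualCone) {r c : ℝ} (hr : 0 < r)
    (h : D.residual e t x c ≤ r / (r + 1)) : D.Invariant e t r x c :=
  ⟨hx, exists_isGradCert_of_residual_le he he0 hx hr h⟩

theorem isCert_of_residual_le (he : e ∈ interior D.cone)
    (hx : x ∈ interior D.dualCone) {r c : ℝ} (hr : 0 < r)
    (h : D.residual e t x c ≤ r / (r + 1)) : D.IsCert x (t - c • e) := by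
  have hr1 : r / (r + 1) < 1 := by rw [div_lt_one (by linarith)]; linarith
  have h1 := h.trans_lt hr1
  exact ⟨interior_subset (mem_interior_cone_of_residual_lt_one he hx h1), hx,
    interior_subset (hessInv_mem_interior_dualCone hx h1)⟩

theorem residual_le_of_isGradCert (he : e ∈ interior D.cone) (hx : x ∈ interior D.dualCone)
    {rN c : ℝ} (hrN : rN < 1) (hy : D.IsGradCert y (t - c • e))
    (h : D.localNorm x (x - y) ≤ rN) : D.residual e t x c ≤ rN / (1 - rN) := by
  refine (residual_le he hx hy (h.trans_lt hrN)).trans ?_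
  have := localNorm_nonneg x (x - y)
  have : 0 < 1 - rN := by linarith
  gcongr
  linarith

theorem localNorm_smul_left (hx : x ∈ interior D.dualCone) {k : ℝ} (hk : 0 < k) (v : D.E) :
    D.localNorm (k • x) v = k⁻¹ * D.localNorm x v := by
  have h0 := localNorm_nonneg x v
  rw [← sq_eq_sq₀ (localNorm_nonneg _ _) (by positivity), mul_pow, localNorm_sq hx,
    localNorm_sq (smul_mem_interior_dualCone hx hk), hess_smul hx hk, inner_smul_right]

theorem hessInv_smul_left (he : e ∈ interior D.cone) (hx : x ∈ interior D.dualCone) {k : ℝ}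
    (hk : 0 < k) (s : D.E) : D.hessInv (k • x) s = (k ^ 2) • D.hessInv x s := by
  have hkx := smul_mem_interior_dualCone hx hk
  refine hess_injective he hkx ?_
  rw [hess_hessInv he hkx, hess_smul hx hk, map_smul, hess_hessInv he hx, smul_smul, ← mul_pow,
    inv_mul_cancel₀ hk.ne', one_pow, one_smul]

/-- With k = -1/c₀, homogeneity turns the residual of t - c₀e at k x₁ into ‖x₁ - H(x₁)⁻¹e - k
H(x₁)⁻¹t‖ at x₁, which is at most δ + k‖t‖*. The choice of c₀ makes this sum equal to r/(r + 1). -/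
theorem invariant_init (he : e ∈ interior D.cone) (he0 : e ≠ 0) {x₁ : D.E}
    (hx : x₁ ∈ interior D.dualCone) (ht : t ≠ 0) {r : ℝ} (hr : 0 < r)
    (h : D.dualNorm x₁ (-D.grad x₁ - e) < r / (r + 1)) :
    D.Invariant e t r ((-1 / D.initBound e t r x₁) • x₁) (D.initBound e t r x₁) := by
  have hδ : D.dualNorm x₁ (-D.grad x₁ - e) = D.localNorm x₁ (x₁ - D.hessInv x₁ e) := by
    rw [dualNorm_eq he hx, map_sub, map_neg, hessInv_grad he hx, neg_neg]
  have hT0 : 0 < D.dualNorm x₁ t := by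
    rw [dualNorm_eq he hx]
    refine (localNorm_nonneg _ _).lt_of_ne' fun h0 => ht ?_
    rw [← hess_hessInv he hx t, localNorm_eq_zero he hx h0, map_zero]
  set δ := D.dualNorm x₁ (-D.grad x₁ - e) with hδdef
  set c₀ := D.initBound e t r x₁ with hc₀
  have hd : 0 < r / (r + 1) - δ := by linarith
  set k := -1 / c₀ with hk
  have hkeq : k * D.dualNorm x₁ t = r / (r + 1) - δ := by
    rw [hk, hc₀, initBound, ← hδdef]
    field_simp
  have hk0 : 0 < k := by
    by_contra! hneg
    nlinarith
  have hck : c₀ = -k⁻¹ := by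
    rw [hk, inv_div, div_neg, div_one, neg_neg]
  refine invariant_of_residual_le he he0 (smul_mem_interior_dualCone hx hk0) hr ?_
  have h1 : k • x₁ - D.hessInv (k • x₁) (t - c₀ • e) =
      k • ((x₁ - D.hessInv x₁ e) + -(k • D.hessInv x₁ t)) := by
    rw [hessInv_smul_left he hx hk0, hck, map_sub, map_smul, neg_smul, sub_neg_eq_add, smul_add,
      smul_smul, pow_two, mul_assoc, mul_inv_cancel₀ hk0.ne', mul_one]
    module
  rw [residual, h1, localNorm_smul_left hx hk0, localNorm_smul, abs_of_pos hk0,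
    inv_mul_cancel_left₀ hk0.ne']
  refine (localNorm_add_le hx _ _).trans ?_
  rw [localNorm_neg, localNorm_smul, abs_of_pos hk0, ← dualNorm_eq he hx, ← hδ, hkeq]
  linarith

theorem exists_rat_quadratic (he : e ∈ interior D.cone) (he0 : e ≠ 0)
    (hx : x ∈ interior D.dualCone) (hxr : D.IsRatVec x) (hL : D.IsRatLam) (ht : D.IsRatVec t)
    (her : D.IsRatVec e) {r : ℝ} (hr : 0 ≤ r) (hrr : ∃ a : ℚ, r = (a : ℝ)) :
    ∃ α β γ : ℚ, 0 < α ∧ ∀ s : ℝ, D.SolvesUpdate e t r x s ↔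
      (α : ℝ) * s ^ 2 + (β : ℝ) * s + (γ : ℝ) = 0 := by
  have hp := hxr.sub (hL.hessInv he hx hxr ht)
  obtain ⟨α, hα⟩ := her.inner (hL.hessInv he hx hxr her)
  obtain ⟨b, hb⟩ := hp.inner her
  obtain ⟨g, hg⟩ := hp.inner (hL.hess hx hxr hp)
  obtain ⟨a, rfl⟩ := hrr
  refine ⟨α, 2 * b, g - (a / (a + 1)) ^ 2, ?_, fun s => ?_⟩
  · have h := inner_hessInv_pos he he0 hx
    rw [hα] at h
    exact_mod_cast h
  · rw [solvesUpdate_iff he hx hr, hα, hb, hg]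
    push_cast
    rfl

theorem isRatVec_newtonPoint (he : e ∈ interior D.cone)
    (hx : x ∈ interior D.dualCone) (hxr : D.IsRatVec x) (hL : D.IsRatLam) (ht : D.IsRatVec t)
    (her : D.IsRatVec e) {c : ℝ} (hc : ∃ a : ℚ, c = (a : ℝ)) :
    D.IsRatVec (D.newtonPoint e t x c) := by
  obtain ⟨a, rfl⟩ := hc
  have h := (hxr.smul 2).sub (hL.hessInv he hx hxr (ht.sub (her.smul a)))
  simpa [newtonPoint] using h

end WSOS

theorem QLinearlyConvergent.of_le {c : ℕ → ℝ} {l K : ℝ} (hK : 0 < K) (hlt : ∀ k, c k < l)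
    (h : ∀ k, K ≤ (c (k + 1) - c k) / (l - c k)) : QLinearlyConvergent c l := by
  have h1 (k : ℕ) : l - c (k + 1) ≤ (1 - K) * (l - c k) := by
    have := (le_div_iff₀ (sub_pos.2 (hlt k))).1 (h k)
    linarith
  -- With K > 1 the first step would already overshoot l.
  have hK1 : K ≤ 1 := by
    have h2 := h1 0
    have h3 := hlt 0
    have h4 := hlt (0 + 1)
    by_contra! h5
    nlinarith
  have h2 (k : ℕ) : l - c k ≤ (1 - K) ^ k * (l - c 0) := by
    induction k with
    | zero => simp
    | succ k ih =>
      refine (h1 k).trans ?_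
      rw [pow_succ', mul_assoc]
      exact mul_le_mul_of_nonneg_left ih (by linarith)
  refine ⟨?_, 1 - K, by linarith, by linarith, fun k => ?_⟩
  · have h3 : Tendsto (fun k => (1 - K) ^ k * (l - c 0)) atTop (𝓝 0) := by
      simpa using (tendsto_pow_atTop_nhds_zero_of_lt_one (by linarith)
        (by linarith : 1 - K < 1)).mul_const (l - c 0)
    have h4 : Tendsto (fun k => l - c k) atTop (𝓝 0) :=
      squeeze_zero (fun k => (sub_pos.2 (hlt k)).le) h2 h3
    simpa using (tendsto_const_nhds (x := l)).sub h4
  · rw [abs_sub_comm, abs_sub_comm (c k), abs_of_pos (sub_pos.2 (hlt _)),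
      abs_of_pos (sub_pos.2 (hlt _))]
    exact h1 k

/-! ### Estimates for one pass of the loop -/

namespace WSOS

variable {n m : ℕ} {D : WSOS n m} {x y e t : D.E} {r rN c cp cstar : ℝ}

theorem radius_bounds (hr : 0 < r) (hr4 : r ≤ 1 / 4) (h1 : r ^ 2 / (1 - 2 * r) < rN)
    (h2 : rN < r / (1 + 2 * r)) : 0 < rN ∧ rN ≤ 1 / 2 ∧ rN / (1 - rN) < r / (r + 1) := by
  have h3 : 0 < rN := lt_of_le_of_lt (div_nonneg (sq_nonneg r) (by linarith)) h1
  rw [lt_div_iff₀ (by linarith)] at h2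
  have h4 : rN ≤ 1 / 2 := by nlinarith
  refine ⟨h3, h4, ?_⟩
  rw [div_lt_div_iff₀ (by linarith) (by linarith)]
  linarith

theorem rounding_spec (he : e ∈ interior D.cone) (he0 : e ≠ 0) {xp xN : D.E}
    (hxp : xp ∈ interior D.dualCone) (hr4 : r ≤ 1 / 4)
    (h1 : r ^ 2 / (1 - 2 * r) < rN) (hle : D.localNorm xp (xp - y) ≤ r ^ 2 / (1 - 2 * r))
    (h : D.IsRounding (D.denominator r rN xp) xp xN) :
    xN ∈ interior D.dualCone ∧ D.localNorm xN (xN - y) ≤ rN := by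
  have hε : 0 ≤ r ^ 2 / (1 - 2 * r) := div_nonneg (sq_nonneg r) (by linarith)
  exact h.mem_and_le hxp hε h1 hle (denominator_pos he he0 hxp h1 (hε.trans_lt h1))
    (Nat.le_ceil _)

theorem IsBoundUpdate.residual_eq (h : D.IsBoundUpdate e t r x cp) :
    D.residual e t x cp = r / (r + 1) := h.1

theorem IsBoundUpdate.lt (he : e ∈ interior D.cone) (he0 : e ≠ 0) (hx : x ∈ interior D.dualCone)
    (hr : 0 ≤ r) (hres : D.residual e t x c < r / (r + 1)) (h : D.IsBoundUpdate e t r x cp) :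
    c < cp := by
  obtain ⟨cp', h', hlt⟩ := exists_isBoundUpdate he he0 hx hr hres
  rwa [h.unique h']

theorem IsBoundRounding.lt {c' : ℚ} (hc : c < cp) (h : IsBoundRounding c cp c') :
    c < (c' : ℝ) := by
  have := h.1.1
  linarith

/-- Between c and c₊ the residual must climb by at least ρ, at slope at most ‖e‖*_x; the gap
estimate bounds this slope by 2ν/(c* - c). -/
theorem rate_le (he : e ∈ interior D.cone) (he0 : e ≠ 0) (hx : x ∈ interior D.dualCone)
    (hrN : rN ≤ 1 / 2) (hy : D.IsGradCert y (t - c • e))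
    (hxy : D.localNorm x (x - y) ≤ rN) (hgt : IsGreatest {c : ℝ | t - c • e ∈ D.cone} cstar)
    (hcp : D.IsBoundUpdate e t r x cp) (hc : c < cp) {c' : ℚ} (hc' : IsBoundRounding c cp c') :
    1 / 2 * (r / (r + 1) - rN / (1 - rN)) * (1 / (2 * Fintype.card (Σ i, Fin (D.L i)))) ≤
      ((c' : ℝ) - c) / (cstar - c) := by
  have hne := nonempty_index he he0
  have hν : (0 : ℝ) < Fintype.card (Σ i, Fin (D.L i)) := by exact_mod_cast Fintype.card_pos
  have hlt := hy.lt_bound he hgt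
  have h1 := gap_mul_dualNorm_le he hx hy (hxy.trans hrN) hlt.le hgt.1
  have h2 := residual_le_of_isGradCert he hx (by linarith) hy hxy
  have h3 := residual_le_add (t := t) he hx hc.le
  rw [hcp.residual_eq] at h3
  have h4 := hc'.1.1
  have hd : 0 ≤ D.dualNorm x e := Real.sqrt_nonneg _
  set ν : ℝ := (Fintype.card (Σ i, Fin (D.L i)) : ℝ)
  set d := D.dualNorm x e
  have h5 : (r / (r + 1) - rN / (1 - rN)) * (cstar - c) ≤ (cp - c) * (2 * ν) :=
    calc (r / (r + 1) - rN / (1 - rN)) * (cstar - c) ≤ (cp - c) * d * (cstar - c) :=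
          mul_le_mul_of_nonneg_right (by linarith) (by linarith)
      _ = (cp - c) * ((cstar - c) * d) := by ring
      _ ≤ (cp - c) * (2 * ν) := mul_le_mul_of_nonneg_left h1 (by linarith)
  rw [le_div_iff₀ (by linarith)]
  calc _ = 1 / 2 * ((r / (r + 1) - rN / (1 - rN)) * (cstar - c)) / (2 * ν) := by ring
    _ ≤ 1 / 2 * ((cp - c) * (2 * ν)) / (2 * ν) := by gcongr
    _ = 1 / 2 * (cp - c) := by field_simp
    _ ≤ (c' : ℝ) - c := by linarith

end WSOS

/-! ### The main theorem -/

theorem mainTheorem4 {n m : ℕ} (D : WSOS n m)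
    (hdual : (interior D.dualCone).Nonempty)
    (e : D.E) (he : D.poly e = 1) (he_int : e ∈ interior D.cone) :
    ∃ C : ℝ, 0 < C ∧
    ∀ r rN : ℝ, 0 < r → r ≤ 1 / 4 → r ^ 2 / (1 - 2 * r) < rN → rN < r / (1 + 2 * r) →
    ∀ ρ : ℝ, ρ = r / (r + 1) - rN / (1 - rN) →
    0 < ρ ∧
    ∀ t : D.E,
      -- the initialization establishes the loop invariant
      (∀ x₁ ∈ interior D.dualCone, t ≠ 0 → D.dualNorm x₁ (-D.grad x₁ - e) < r / (r + 1) →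
        D.Invariant e t r ((-1 / D.initBound e t r x₁) • x₁) (D.initBound e t r x₁)) ∧
      ∃ cstar : ℝ, IsGreatest {c : ℝ | t - c • e ∈ D.cone} cstar ∧
      -- one iteration
      (∀ (x y : D.E) (c : ℝ), x ∈ interior D.dualCone → D.IsGradCert y (t - c • e) →
        D.localNorm x (x - y) ≤ r →
        ∀ xp : D.E, xp = D.newtonPoint e t x c →
        ∀ N : ℕ, N = D.denominator r rN xp →
        -- the Newton step
        xp ∈ interior D.dualCone ∧
        D.localNorm xp (xp - y) ≤ r ^ 2 / (1 - 2 * r) ∧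
        (D.IsRatLam → D.IsRatVec t → D.IsRatVec e → D.IsRatVec x → (∃ a : ℚ, c = (a : ℝ)) →
          D.IsRatVec xp) ∧
        -- the rounding of the certificate
        0 < N ∧ (∃ xN, D.IsRounding N xp xN) ∧
        ∀ xN, D.IsRounding N xp xN →
          D.IsRatVec xN ∧ xN ∈ interior D.dualCone ∧ D.localNorm xN (xN - y) ≤ rN ∧
          -- the update of the bound
          (D.IsRatLam → D.IsRatVec t → D.IsRatVec e → (∃ a : ℚ, r = (a : ℝ)) →
            ∃ α β γ : ℚ, 0 < α ∧ ∀ s : ℝ,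
              D.SolvesUpdate e t r xN s ↔ (α : ℝ) * s ^ 2 + (β : ℝ) * s + (γ : ℝ) = 0) ∧
          (∃ cp, D.IsBoundUpdate e t r xN cp) ∧
          ∀ cp, D.IsBoundUpdate e t r xN cp →
            c < cp ∧
            (∃ yp, D.IsGradCert yp (t - cp • e) ∧ D.localNorm xN (xN - yp) ≤ r) ∧
            -- the rounding of the bound
            (∃ c' : ℚ, WSOS.IsBoundRounding c cp c') ∧
            ∀ c' : ℚ, WSOS.IsBoundRounding c cp c' →
              c < (c' : ℝ) ∧
              D.Invariant e t r xN (c' : ℝ) ∧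
              D.IsCert xN (t - (c' : ℝ) • e) ∧
              c < cstar ∧
              1 / 2 * ρ * C ≤ ((c' : ℝ) - c) / (cstar - c)) ∧
      -- the whole run, from any starting state that satisfies the invariant
      (∀ (x₀ : D.E) (c₀ : ℝ), D.Invariant e t r x₀ c₀ →
        (∃ (x : ℕ → D.E) (c : ℕ → ℝ), x 0 = x₀ ∧ c 0 = c₀ ∧ D.IsRun e t r rN x c) ∧
        ∀ (x : ℕ → D.E) (c : ℕ → ℝ), x 0 = x₀ → c 0 = c₀ → D.IsRun e t r rN x c →
          (∀ k, D.Invariant e t r (x k) (c k)) ∧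
          StrictMono c ∧
          (∀ k, c k < cstar ∧ 1 / 2 * ρ * C ≤ (c (k + 1) - c k) / (cstar - c k)) ∧
          QLinearlyConvergent c cstar) := by
  have he0 := WSOS.ne_zero_of_poly_eq_one he
  have hne := WSOS.nonempty_index he_int he0
  have hC : 0 < 1 / (2 * (Fintype.card (Σ i, Fin (D.L i)) : ℝ)) := by
    have : (0 : ℝ) < Fintype.card (Σ i, Fin (D.L i)) := by exact_mod_cast Fintype.card_pos
    positivity
  refine ⟨1 / (2 * Fintype.card (Σ i, Fin (D.L i))), hC, fun r rN hr hr4 h1 h2 ρ hρ => ?_⟩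
  obtain ⟨hrN0, hrN, hlt⟩ := WSOS.radius_bounds hr hr4 h1 h2
  have hρ0 : 0 < ρ := by rw [hρ]; linarith
  refine ⟨hρ0, fun t => ⟨fun x₁ hx₁ ht hδ => WSOS.invariant_init he_int he0 hx₁ ht hr hδ, ?_⟩⟩
  obtain ⟨cstar, hcstar⟩ := WSOS.exists_isGreatest_bound hdual he_int he0 t
  refine ⟨cstar, hcstar, ?_⟩
  -- The statement about runs is deduced from the statement about one iteration.
  rw [and_iff_left_of_imp]
  · intro x y c hx hy hxy xp hxp N hN
    obtain ⟨hp1, hp2⟩ := WSOS.newton_mem_and_le he_int hx hy hr4 hxy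
    change D.newtonPoint e t x c ∈ _ at hp1
    change D.localNorm (D.newtonPoint e t x c) (D.newtonPoint e t x c - y) ≤ _ at hp2
    rw [← hxp] at hp1 hp2
    have hNpos : 0 < N := hN ▸ WSOS.denominator_pos he_int he0 hp1 h1 hrN0
    refine ⟨hp1, hp2, fun hL ht her hxr hc => hxp ▸
      WSOS.isRatVec_newtonPoint he_int hx hxr hL ht her hc, hNpos, D.exists_isRounding hNpos xp,
      fun xN hxN => ?_⟩
    obtain ⟨hN1, hN2⟩ := WSOS.rounding_spec he_int he0 hp1 hr4 h1 hp2 (hN ▸ hxN)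
    have hres := (WSOS.residual_le_of_isGradCert he_int hN1 (by linarith) hy hN2).trans_lt hlt
    obtain ⟨cp₀, hcp₀, -⟩ := WSOS.exists_isBoundUpdate he_int he0 hN1 hr.le hres
    refine ⟨hxN.isRatVec, hN1, hN2, fun hL ht her hrr => WSOS.exists_rat_quadratic he_int he0 hN1
      hxN.isRatVec hL ht her hr.le hrr, ⟨cp₀, hcp₀⟩, fun cp hcp => ?_⟩
    have hccp := hcp.lt he_int he0 hN1 hr.le hres
    refine ⟨hccp, (WSOS.invariant_of_residual_le he_int he0 hN1 hr hcp.residual_eq.le).2,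
      WSOS.exists_isBoundRounding hccp, fun c' hc' => ?_⟩
    have hcc' := hc'.lt hccp
    have hres' := WSOS.residual_convex hN1 hres.le hcp.residual_eq.le ⟨hcc'.le, hc'.1.2⟩
    exact ⟨hcc', WSOS.invariant_of_residual_le he_int he0 hN1 hr hres',
      WSOS.isCert_of_residual_le he_int hN1 hr hres', hy.lt_bound he_int hcstar,
      hρ ▸ WSOS.rate_le he_int he0 hN1 hrN hy hN2 hcstar hcp hccp hc'⟩
  · intro hiter x₀ c₀ hinv₀
    have hstep (x : D.E) (c : ℝ) (hinv : D.Invariant e t r x c) :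
        ∃ (x' : D.E) (c' : ℝ), D.Invariant e t r x' c' ∧ D.IsStep e t r rN x c x' c' := by
      obtain ⟨hx, y, hy, hxy⟩ := hinv
      obtain ⟨-, -, -, -, ⟨xN, hxN⟩, hall⟩ := hiter x y c hx hy hxy _ rfl _ rfl
      obtain ⟨-, -, -, -, ⟨cp, hcp⟩, hall⟩ := hall xN hxN
      obtain ⟨-, -, ⟨c', hc'⟩, hall⟩ := hall cp hcp
      exact ⟨xN, c', (hall c' hc').2.1, hxN, cp, c', hcp, hc', rfl⟩
    have hspec (x : D.E) (c : ℝ) (hinv : D.Invariant e t r x c) (x' : D.E) (c' : ℝ)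
        (h : D.IsStep e t r rN x c x' c') : c < c' ∧ D.Invariant e t r x' c' ∧ c < cstar ∧
          1 / 2 * ρ * (1 / (2 * Fintype.card (Σ i, Fin (D.L i)))) ≤ (c' - c) / (cstar - c) := by
      obtain ⟨hx, y, hy, hxy⟩ := hinv
      obtain ⟨hxN, cp, a, hcp, ha, rfl⟩ := h
      obtain ⟨-, -, -, -, -, hall⟩ := hiter x y c hx hy hxy _ rfl _ rfl
      obtain ⟨-, -, -, -, -, hall⟩ := hall x' hxN
      obtain ⟨-, -, -, hall⟩ := hall cp hcp
      obtain ⟨h1, h2, -, h3, h4⟩ := hall a ha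
      exact ⟨h1, h2, h3, h4⟩
    constructor
    · choose! X' C' hX hS using hstep
      let S : ℕ → D.E × ℝ := fun k => (fun z => (X' z.1 z.2, C' z.1 z.2))^[k] (x₀, c₀)
      have hS1 (k : ℕ) : S (k + 1) = (X' (S k).1 (S k).2, C' (S k).1 (S k).2) :=
        Function.iterate_succ_apply' _ _ _
      have hSinv (k : ℕ) : D.Invariant e t r (S k).1 (S k).2 := by
        induction k with
        | zero => exact hinv₀
        | succ k ih => rw [hS1]; exact hX _ _ ih
      refine ⟨fun k => (S k).1, fun k => (S k).2, rfl, rfl, fun k => ?_⟩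
      simp only [hS1]
      exact hS _ _ (hSinv k)
    · rintro x c rfl rfl hrun
      have hinv (k : ℕ) : D.Invariant e t r (x k) (c k) := by
        induction k with
        | zero => exact hinv₀
        | succ k ih => exact (hspec _ _ ih _ _ (hrun k)).2.1
      have hk (k : ℕ) := hspec _ _ (hinv k) _ _ (hrun k)
      exact ⟨hinv, strictMono_nat_of_lt_succ fun k => (hk k).1, fun k => (hk k).2.2,
        QLinearlyConvergent.of_le (by positivity) (fun k => (hk k).2.2.1)
          fun k => (hk k).2.2.2⟩
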